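/- Let $f\in\mathbb{Z}[x,z]$ be a homogeneous polynomial of degree $5$ that is irreducible as an element of $\mathbb{Q}[x,z]$ (in particular, any homogeneous $f$ of degree $5$ that is irreducible in $\mathbb{Z}[x,z]$). For a positive integer $N$, let \[\delta(N)=\#\{(x,z)\in\mathbb{Z}^2 : |x|,|z|\le N,\ \gcd(x,z)=1,\ p^2\mid f(x,z)\text{ for some prime } p>N\}.\] Then for every $\epsilon>0$ there is a constant $C>0$, depending only on $f$ and $\epsilon$, such that \[\delta(N)\le C\,N^{(5+\sqrt{113})/8+\epsilon}\qquad\text{for all integers } N\ge 1.\] -/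

import Mathlib

/-- The set of coprime integer pairs `(x, z)` in the box `[-N, N]²` such that `p ^ 2 ∣ f(x, z)`
for some prime `p > N`. -/
def largeSquareDivisorPairs (f : MvPolynomial (Fin 2) ℤ) (N : ℕ) : Set (ℤ × ℤ) :=
  {v | |v.1| ≤ (N : ℤ) ∧ |v.2| ≤ (N : ℤ) ∧ Int.gcd v.1 v.2 = 1 ∧
    ∃ p : ℕ, p.Prime ∧ N < p ∧ (p : ℤ) ^ 2 ∣ MvPolynomial.eval ![v.1, v.2] f}

/-- The set is finite, so that its `Set.ncard` is the true number of its elements. -/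
theorem largeSquareDivisorPairs_finite (f : MvPolynomial (Fin 2) ℤ) (N : ℕ) :
    (largeSquareDivisorPairs f N).Finite := by
  refine (((Set.finite_Icc (-(N : ℤ)) N).prod (Set.finite_Icc (-(N : ℤ)) N))).subset ?_
  rintro ⟨x, z⟩ ⟨hx, hz, -⟩
  exact ⟨abs_le.mp hx, abs_le.mp hz⟩

/-- The number `δ(N)` of coprime integer pairs `(x, z)` with `|x|, |z| ≤ N` such that
`p ^ 2 ∣ f(x, z)` for some prime `p > N`. -/
noncomputable def largeSquareDivisorCount (f : MvPolynomial (Fin 2) ℤ) (N : ℕ) : ℕ :=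
  (largeSquareDivisorPairs f N).ncard

/-! Write `f = ∑ Fᵢ xⁱ z⁵⁻ⁱ`, let `n` be about `N^(1/40)`, and split the primes at `n ^ 78`.

Medium primes. Irreducibility gives a nonzero integer `D` in the ideal generated by `F` and `F'`. If
`p > N` divides neither `D` nor `F₅`, Hensel's lemma (`sq_dvd_det_of_dvd_det`) shows that two zeros
of `f` modulo `p²` with equal slopes modulo `p` have determinant divisible by `p²`. Once signs are
sorted, this determinant is at most `N² < p²`, so it vanishes. Hence each prime accounts for at most
20 pairs, and the primes up to `n ^ 78` for at most `20 n ^ 78`.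

Large primes. Here `f(x, z) = p² m` with `m ≪ n ^ 44`, so `f(x, z) = κ d w²` with `κ` bounded and `d
≪ n ^ 44` squarefree and prime to `F₅`. The slopes modulo the primes of `d` sort the points into at
most `5 ^ ω(d)` classes, each inside a lattice of determinant `d`. If `l ≤ √d` is the length of a
shortest vector, a class lies on `≪ n ^ 40 l / d + 1` parallel lines. On each line `f` becomes a
quintic `G(t)` with `|t| ≤ T ≈ n ^ 40 / l`, and the integral points of `κ w² = G(t)` number `≪ n ^ 4
√T` (`card_curve_points_le`). The latter is a `q`-adic auxiliary polynomial argument: in one residue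
class modulo `q`, some `P₁ + w P₂` is divisible by a power of `q` that exceeds its size, so it
vanishes. Summing over `d` gives `≪ n ^ 77`.

Altogether the count is `≪ N ^ (78/40)`, and `78/40 ≤ (5 + √113)/8`. -/

/-! ### Integral points on `κ w² = G(t)` by `q`-adic auxiliary polynomials -/

open Polynomial in
/-- An integer polynomial that interpolates, to any `q`-adic precision, the branch through
`(t₀, w₀)` of the curve `κ w² = G(t)`. -/
theorem exists_padic_branch (G : ℤ[X]) (κ t₀ w₀ : ℤ) (q : ℕ) (hq : q.Prime)
    (h : ¬ (q : ℤ) ∣ 2 * κ * w₀) (n : ℕ) :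
    ∃ φ : ℤ[X], ∀ t w : ℤ, (q : ℤ) ∣ t - t₀ → (q : ℤ) ∣ w - w₀ → G.eval t = κ * w ^ 2 →
      (q : ℤ) ^ (n + 1) ∣ w - φ.eval (t - t₀) := by
  obtain ⟨i, j, hij⟩ : ∃ i j : ℤ, i * (2 * κ * w₀) + j * q = 1 := by
    have hc : IsCoprime (2 * κ * w₀) (q : ℤ) :=
      ((Nat.prime_iff_prime_int.mp hq).coprime_iff_not_dvd.mpr h).symm
    exact hc
  induction n with
  | zero => exact ⟨C w₀, fun t w _ hw _ => by simpa using hw⟩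
  | succ n ih =>
    obtain ⟨φ, hφ⟩ := ih
    -- Newton iteration with the fixed inverse `i` of the derivative `2κw₀`. The error is multiplied
    -- by `1 - 2iκw` plus a multiple of `q`, hence by a multiple of `q`.
    refine ⟨φ - C i * (C κ * φ ^ 2 - G.comp (X + C t₀)), fun t w ht hw hG => ?_⟩
    obtain ⟨r, hr⟩ := hφ t w ht hw hG
    obtain ⟨s, hs⟩ := hw
    simp only [eval_sub, eval_mul, eval_C, eval_pow, eval_comp, eval_add, eval_X, sub_add_cancel]
    rw [hG]
    have h1 : φ.eval (t - t₀) = w - q ^ (n + 1) * r := by linarith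
    have h2 : w = w₀ + q * s := by linarith
    rw [h1]
    refine ⟨r * (j - 2 * i * κ * s + i * κ * q ^ n * r), ?_⟩
    have h3 : 1 - 2 * i * κ * w + i * κ * (q ^ (n + 1) * r)
        = q * (j - 2 * i * κ * s + i * κ * q ^ n * r) := by
      rw [h2]; linear_combination -hij
    linear_combination (q : ℤ) ^ (n + 1) * r * h3

-- Siegel's lemma by pigeonhole. The weights `T ^ (k - 1 - i)` make every monomial of comparable
-- size when `|t| ≤ T`; the divisibility by `q ^ (E - l)` is what makes the value at any `t ≡ t₀`
-- modulo `q` divisible by `q ^ E`.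
open Polynomial in
theorem exists_aux_polynomials (φ : ℤ[X]) (t₀ : ℤ) (q k T W E : ℕ) (hq : 0 < q) (hk : 0 < k)
    (hE : q ^ (∑ l ∈ Finset.range E, (E - l)) ≤ (W * T ^ (k - 1)) ^ k) :
    ∃ P₁ P₂ : ℤ[X], (P₁ ≠ 0 ∨ P₂ ≠ 0) ∧ P₁.natDegree < k ∧ P₂.natDegree < k ∧
      (∀ i < k, |P₁.coeff i| ≤ (W * T ^ (k - 1 - i) : ℕ)) ∧
      (∀ i < k, |P₂.coeff i| ≤ (T ^ (k - 1 - i) : ℕ)) ∧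
      ∀ l < E, (q : ℤ) ^ (E - l) ∣
        (P₁.comp (X + C t₀) + φ * P₂.comp (X + C t₀)).coeff l := by
  classical
  let b : Fin k ⊕ Fin k → ℕ :=
    Sum.elim (fun i => W * T ^ (k - 1 - i)) (fun i => T ^ (k - 1 - i))
  let A : (Fin k → ℤ) → ℤ[X] := fun a => ∑ i : Fin k, C (a i) * X ^ (i : ℕ)
  have hAsub : ∀ a a', A a - A a' = A (a - a') := by
    intro a a'
    simp [A, ← Finset.sum_sub_distrib, sub_mul]
  have hAcoeff : ∀ a (i : Fin k), (A a).coeff i = a i := by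
    intro a i
    simp [A, coeff_X_pow, Fin.val_inj]
  have hAdeg : ∀ a, (A a).natDegree < k := by
    intro a
    refine lt_of_le_of_lt (natDegree_sum_le_of_forall_le (n := k - 1) _ _ fun i _ => ?_) (by omega)
    refine (natDegree_C_mul_X_pow_le _ _).trans ?_
    have := i.2
    omega
  let Ψ : (Fin k ⊕ Fin k → ℤ) → ℤ[X] := fun a =>
    (A (a ∘ Sum.inl)).comp (X + C t₀) + φ * (A (a ∘ Sum.inr)).comp (X + C t₀)
  let box := Fintype.piFinset fun j => Finset.Icc (0 : ℤ) (b j)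
  let m : (Fin k ⊕ Fin k → ℤ) → ((l : Fin E) → ZMod (q ^ (E - l))) :=
    fun a l => ((Ψ a).coeff l : ZMod (q ^ (E - l)))
  have : ∀ l : Fin E, NeZero (q ^ (E - (l : ℕ))) := fun l => ⟨by positivity⟩
  have hcard : (Finset.univ : Finset ((l : Fin E) → ZMod (q ^ (E - l)))).card < box.card := by
    have h1 : (Finset.univ : Finset ((l : Fin E) → ZMod (q ^ (E - l)))).card
        = q ^ (∑ l ∈ Finset.range E, (E - l)) := by
      rw [Finset.card_univ, Fintype.card_pi]
      simp only [ZMod.card]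
      rw [Finset.prod_pow_eq_pow_sum, Finset.sum_range]
    have h2 : box.card = ∏ j, (b j + 1) := by
      simp [box, Fintype.card_piFinset]
    rw [h1, h2]
    refine lt_of_le_of_lt hE ?_
    have h3 : (W * T ^ (k - 1)) ^ k = ∏ j, b j := by
      simp only [b, Fintype.prod_sum_type, Sum.elim_inl, Sum.elim_inr]
      -- Pairing index `i` of `P₁` with index `k - 1 - i` of `P₂` makes each of the `k` products
      -- equal to `W * T ^ (k - 1)`.
      rw [← Equiv.prod_comp Fin.revPerm (fun i : Fin k => T ^ (k - 1 - (i : ℕ))),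
        ← Finset.prod_mul_distrib]
      rw [Finset.prod_congr rfl (g := fun _ => W * T ^ (k - 1))]
      · simp
      · intro i _
        have := i.2
        simp only [Fin.revPerm_apply, Fin.val_rev]
        rw [mul_assoc, ← pow_add]
        congr 2
        omega
    rw [h3]
    by_cases h0 : ∀ j, 0 < b j
    · exact Finset.prod_lt_prod_of_nonempty (fun j _ => h0 j) (fun j _ => Nat.lt_succ_self _)
        ⟨Sum.inl ⟨0, hk⟩, Finset.mem_univ _⟩
    · push Not at h0
      obtain ⟨j, hj⟩ := h0
      rw [Finset.prod_eq_zero (Finset.mem_univ j) (by omega)]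
      exact Finset.prod_pos fun j _ => Nat.succ_pos _
  obtain ⟨a, ha, a', ha', hne, hm⟩ := Finset.exists_ne_map_eq_of_card_lt_of_maps_to hcard
    (f := m) (fun _ _ => Finset.mem_coe.mpr (Finset.mem_univ _))
  have hd : ∀ j, |(a - a') j| ≤ b j := by
    intro j
    have h1 := Finset.mem_Icc.mp (Fintype.mem_piFinset.mp ha j)
    have h2 := Finset.mem_Icc.mp (Fintype.mem_piFinset.mp ha' j)
    rw [Pi.sub_apply, abs_le]
    constructor <;> linarith [h1.1, h1.2, h2.1, h2.2]
  refine ⟨A ((a - a') ∘ Sum.inl), A ((a - a') ∘ Sum.inr), ?_, hAdeg _, hAdeg _, ?_, ?_, ?_⟩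
  · by_contra hcon
    push Not at hcon
    apply hne
    rw [← sub_eq_zero]
    funext j
    rcases j with i | i
    · have := hAcoeff ((a - a') ∘ Sum.inl) i
      rw [hcon.1] at this
      simpa using this.symm
    · have := hAcoeff ((a - a') ∘ Sum.inr) i
      rw [hcon.2] at this
      simpa using this.symm
  · intro i hi
    have := hAcoeff ((a - a') ∘ Sum.inl) ⟨i, hi⟩
    simp only at this
    rw [this]
    exact hd (Sum.inl ⟨i, hi⟩)
  · intro i hi
    have := hAcoeff ((a - a') ∘ Sum.inr) ⟨i, hi⟩
    simp only at this
    rw [this]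
    exact hd (Sum.inr ⟨i, hi⟩)
  · intro l hl
    have h1 := congrFun hm ⟨l, hl⟩
    have h2 : Ψ a - Ψ a' = (A ((a - a') ∘ Sum.inl)).comp (X + C t₀)
        + φ * (A ((a - a') ∘ Sum.inr)).comp (X + C t₀) := by
      have e1 : (a - a') ∘ Sum.inl = a ∘ Sum.inl - a' ∘ Sum.inl := rfl
      have e2 : (a - a') ∘ Sum.inr = a ∘ Sum.inr - a' ∘ Sum.inr := rfl
      rw [e1, e2, ← hAsub, ← hAsub, sub_comp, sub_comp]
      simp only [Ψ]
      ring
    rw [← h2, coeff_sub]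
    have h3 := (ZMod.intCast_eq_intCast_iff_dvd_sub _ _ _).mp h1.symm
    simpa using h3

open Polynomial in
theorem pow_dvd_eval_of_dvd_coeff (P : ℤ[X]) (q : ℤ) (E : ℕ)
    (h : ∀ l < E, q ^ (E - l) ∣ P.coeff l) (t : ℤ) (ht : q ∣ t) : q ^ E ∣ P.eval t := by
  rw [eval_eq_sum_range]
  refine Finset.dvd_sum fun l _ => ?_
  rcases lt_or_ge l E with hl | hl
  · have := mul_dvd_mul (h l hl) (pow_dvd_pow_of_dvd ht l)
    rwa [← pow_add, Nat.sub_add_cancel hl.le] at this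
  · exact dvd_mul_of_dvd_right ((pow_dvd_pow q hl).trans (pow_dvd_pow_of_dvd ht l)) _

open Polynomial in
theorem abs_eval_le_of_abs_coeff_le (P : ℤ[X]) (k T W : ℕ) (hk : P.natDegree < k)
    (h : ∀ i < k, |P.coeff i| ≤ (W * T ^ (k - 1 - i) : ℕ)) (t : ℤ) (ht : |t| ≤ T) :
    |P.eval t| ≤ k * (W * T ^ (k - 1)) := by
  rw [eval_eq_sum_range' hk]
  refine (Finset.abs_sum_le_sum_abs _ _).trans ?_
  have : ∀ i ∈ Finset.range k, |P.coeff i * t ^ i| ≤ (W * T ^ (k - 1) : ℤ) := by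
    intro i hi
    have hi := Finset.mem_range.mp hi
    rw [abs_mul, abs_pow]
    calc |P.coeff i| * |t| ^ i ≤ (W * T ^ (k - 1 - i) : ℕ) * (T : ℤ) ^ i := by
          gcongr
          exact h i hi
      _ = W * T ^ (k - 1) := by
          push_cast
          rw [mul_assoc, ← pow_add]
          congr 2
          omega
  simpa using Finset.sum_le_card_nsmul _ _ _ this

theorem sum_range_sub_id (E : ℕ) : (∑ l ∈ Finset.range E, (E - l)) * 2 = E * (E + 1) := by
  have h1 := Finset.sum_range_reflect (fun l => l + 1) E
  have h2 : ∑ l ∈ Finset.range E, (E - l) = ∑ l ∈ Finset.range E, (l + 1) := by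
    rw [← h1]
    refine Finset.sum_congr rfl fun l hl => ?_
    have := Finset.mem_range.mp hl
    omega
  have h3 := Finset.sum_range_id_mul_two (E + 1)
  rw [Finset.sum_range_succ'] at h3
  rw [h2]
  simpa [mul_comm] using h3

open Polynomial in
/-- Integral points of `κ w² = G(t)`, with `G` of odd degree, in one residue class modulo a
large prime. -/
theorem card_branch_points_le (G : ℤ[X]) (hG : Odd G.natDegree) (κ : ℤ) (q : ℕ)
    (hq : q.Prime) (k T W : ℕ) (t₀ w₀ : ℤ) (hw₀ : ¬ (q : ℤ) ∣ 2 * κ * w₀) (hT : 1 ≤ T)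
    (hk : 3 ≤ k) (hkq : 4 * k < q) (hWT : W * T ^ (k - 1) ≤ q ^ (2 * k - 4)) (hW : 1 ≤ W)
    (S : Finset ℤ)
    (hS : ∀ t ∈ S, |t| ≤ T ∧ (q : ℤ) ∣ t - t₀ ∧
      ∃ w : ℤ, |w| ≤ W ∧ (q : ℤ) ∣ w - w₀ ∧ G.eval t = κ * w ^ 2) :
    S.card ≤ G.natDegree + 2 * k := by
  have hκ : κ ≠ 0 := by rintro rfl; simp at hw₀
  -- `W` is enlarged until `W' * T ^ (k - 1)` lies between `q ^ (2k - 4)` and twice that: large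
  -- enough for the pigeonhole, small enough for the final size bound.
  set W' := q ^ (2 * k - 4) / T ^ (k - 1) + 1 with hW'
  have hTpos : 0 < T ^ (k - 1) := by positivity
  have hWW' : W ≤ W' := by
    have := (Nat.le_div_iff_mul_le hTpos).mpr hWT
    omega
  have hU1 : q ^ (2 * k - 4) ≤ W' * T ^ (k - 1) := by
    have := Nat.lt_div_mul_add (a := q ^ (2 * k - 4)) hTpos
    rw [hW', add_mul]
    omega
  have hU2 : W' * T ^ (k - 1) ≤ 2 * q ^ (2 * k - 4) := by
    have h1 := Nat.div_mul_le_self (q ^ (2 * k - 4)) (T ^ (k - 1))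
    have h2 : T ^ (k - 1) ≤ q ^ (2 * k - 4) := (Nat.le_mul_of_pos_left _ hW).trans hWT
    rw [hW', add_mul]
    omega
  obtain ⟨φ, hφ⟩ := exists_padic_branch G κ t₀ w₀ q hq hw₀ (2 * k - 4)
  have hE : q ^ (∑ l ∈ Finset.range (2 * k - 3), (2 * k - 3 - l)) ≤ (W' * T ^ (k - 1)) ^ k := by
    refine le_trans ?_ (Nat.pow_le_pow_left hU1 k)
    rw [← pow_mul]
    refine Nat.pow_le_pow_right hq.pos ?_
    -- With `E = 2k - 3` the exponent is `(2k - 3)(k - 1)`, which is at most `(2k - 4)k` exactly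
    -- when `k ≥ 3`.
    have h1 := sum_range_sub_id (2 * k - 3)
    obtain ⟨j, rfl⟩ : ∃ j, k = j + 3 := ⟨k - 3, by omega⟩
    have e1 : 2 * (j + 3) - 3 = 2 * j + 3 := by omega
    have e2 : 2 * (j + 3) - 4 = 2 * j + 2 := by omega
    rw [e1] at h1 ⊢
    rw [e2]
    nlinarith
  obtain ⟨P₁, P₂, hne, hd1, hd2, hc1, hc2, hdvd⟩ :=
    exists_aux_polynomials φ t₀ q k T W' (2 * k - 3) hq.pos (by omega) hE
  have hzero : ∀ t ∈ S, ∃ w : ℤ, G.eval t = κ * w ^ 2 ∧ P₁.eval t + w * P₂.eval t = 0 := by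
    intro t ht
    obtain ⟨htT, htq, w, hwW, hwq, hGw⟩ := hS t ht
    refine ⟨w, hGw, ?_⟩
    have h1 := pow_dvd_eval_of_dvd_coeff _ (q : ℤ) _ hdvd (t - t₀) htq
    simp only [eval_add, eval_mul, eval_comp, eval_X, eval_C, sub_add_cancel] at h1
    have h2 := hφ t w htq hwq hGw
    rw [show 2 * k - 4 + 1 = 2 * k - 3 by omega] at h2
    have h3 : (q : ℤ) ^ (2 * k - 3) ∣ P₁.eval t + w * P₂.eval t := by
      have e : P₁.eval t + w * P₂.eval t = (P₁.eval t + φ.eval (t - t₀) * P₂.eval t)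
          + (w - φ.eval (t - t₀)) * P₂.eval t := by ring
      rw [e]
      exact dvd_add h1 (h2.mul_right _)
    refine Int.eq_zero_of_abs_lt_dvd h3 ?_
    have b1 := abs_eval_le_of_abs_coeff_le P₁ k T W' hd1 hc1 t htT
    have b2 := abs_eval_le_of_abs_coeff_le P₂ k T 1 hd2 (by simpa using hc2) t htT
    have b3 : |w * P₂.eval t| ≤ k * (W' * T ^ (k - 1)) := by
      rw [abs_mul]
      calc |w| * |P₂.eval t| ≤ W' * (k * ((1 : ℕ) * T ^ (k - 1))) := by
            gcongr
            exact hwW.trans (by exact_mod_cast hWW')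
        _ = k * (W' * T ^ (k - 1)) := by push_cast; ring
    have b4 : ((W' * T ^ (k - 1) : ℕ) : ℤ) ≤ ((2 * q ^ (2 * k - 4) : ℕ) : ℤ) := by
      exact_mod_cast hU2
    push_cast at b4
    have b5 : (4 * k : ℤ) < q := by exact_mod_cast hkq
    have b6 : (0 : ℤ) < (q : ℤ) ^ (2 * k - 4) := by have := hq.pos; positivity
    calc |P₁.eval t + w * P₂.eval t| ≤ |P₁.eval t| + |w * P₂.eval t| := abs_add_le _ _
      _ ≤ k * (2 * q ^ (2 * k - 4)) + k * (2 * q ^ (2 * k - 4)) := by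
          gcongr
          · exact b1.trans (by gcongr)
          · exact b3.trans (by gcongr)
      _ = 4 * k * q ^ (2 * k - 4) := by ring
      _ < q * q ^ (2 * k - 4) := by gcongr
      _ = q ^ (2 * k - 3) := by rw [← pow_succ']; congr 1; omega
  -- The norm of `P₁ + w P₂` eliminates `w`. It is nonzero because `κ P₁²` has even degree and `G
  -- P₂²` odd degree.
  set R : ℤ[X] := C κ * P₁ ^ 2 - G * P₂ ^ 2 with hR
  have hG0 : G ≠ 0 := by rintro rfl; simp at hG
  have hR0 : R ≠ 0 := by
    intro h0
    have h1 : C κ * P₁ ^ 2 = G * P₂ ^ 2 := sub_eq_zero.mp h0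
    by_cases hP2 : P₂ = 0
    · rw [hP2] at h1
      have : P₁ = 0 := by simpa [hκ] using h1
      exact hne.elim (fun h => h this) (fun h => h hP2)
    · have h2 := congrArg natDegree h1
      rw [natDegree_C_mul hκ, natDegree_mul hG0 (pow_ne_zero 2 hP2), natDegree_pow,
        natDegree_pow] at h2
      obtain ⟨g, hg⟩ := hG
      omega
  have hRdeg : R.natDegree ≤ G.natDegree + 2 * k := by
    refine (natDegree_sub_le _ _).trans (max_le ?_ ?_)
    · refine (natDegree_C_mul_le _ _).trans (natDegree_pow_le.trans ?_)
      omega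
    · refine natDegree_mul_le.trans ?_
      have := natDegree_pow_le (p := P₂) (n := 2)
      omega
  refine le_trans (Finset.card_le_card fun t ht => ?_)
    ((Multiset.toFinset_card_le R.roots).trans ((card_roots' R).trans hRdeg))
  rw [Multiset.mem_toFinset, mem_roots hR0, IsRoot.def]
  obtain ⟨w, hw1, hw2⟩ := hzero t ht
  simp only [hR, eval_sub, eval_mul, eval_C, eval_pow, hw1]
  rw [show P₁.eval t = - (w * P₂.eval t) by linarith]
  ring

open Polynomial in
theorem card_curve_points_of_not_dvd_le (G : ℤ[X]) (hG : Odd G.natDegree) (κ : ℤ) (q : ℕ)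
    (hq : q.Prime) (k T W : ℕ) (hT : 1 ≤ T) (hk : 3 ≤ k) (hkq : 4 * k < q)
    (hWT : W * T ^ (k - 1) ≤ q ^ (2 * k - 4)) (hW : 1 ≤ W) (S : Finset ℤ)
    (hS : ∀ t ∈ S, |t| ≤ T ∧ ¬ (q : ℤ) ∣ 2 * G.eval t ∧
      ∃ w : ℤ, |w| ≤ W ∧ G.eval t = κ * w ^ 2) :
    S.card ≤ (G.natDegree + 2 * k) * q := by
  classical
  have : NeZero q := ⟨hq.ne_zero⟩
  have hqp : Prime (q : ℤ) := Nat.prime_iff_prime_int.mp hq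
  refine (Finset.card_le_mul_card_image (f := fun t : ℤ => (t : ZMod q)) S
    (G.natDegree + 2 * k) ?_).trans (Nat.mul_le_mul_left _ ?_)
  · intro c hc
    obtain ⟨t₀, ht₀, rfl⟩ := Finset.mem_image.mp hc
    obtain ⟨-, hnd, w₀, -, hw₀⟩ := hS t₀ ht₀
    have hnd' : ¬ (q : ℤ) ∣ 2 * κ * w₀ := by
      intro h
      apply hnd
      rw [hw₀, show 2 * (κ * w₀ ^ 2) = 2 * κ * w₀ * w₀ by ring]
      exact h.mul_right _
    refine card_branch_points_le G hG κ q hq k T W t₀ w₀ hnd' hT hk hkq hWT hW _ ?_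
    intro t ht
    obtain ⟨htS, htc⟩ := Finset.mem_filter.mp ht
    obtain ⟨htT, -, w, hwW, hw⟩ := hS t htS
    have hdt : (q : ℤ) ∣ t - t₀ := (ZMod.intCast_eq_intCast_iff_dvd_sub _ _ _).mp htc.symm
    refine ⟨htT, hdt, ?_⟩
    have h1 : (q : ℤ) ∣ κ * ((w - w₀) * (w + w₀)) := by
      have := hdt.trans (sub_dvd_eval_sub t t₀ G)
      rw [hw, hw₀] at this
      rw [show κ * ((w - w₀) * (w + w₀)) = κ * w ^ 2 - κ * w₀ ^ 2 by ring]
      exact this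
    have hκ : ¬ (q : ℤ) ∣ κ := fun h => hnd' ((h.mul_left 2).mul_right _)
    -- Over one residue of `t` there are only the two branches `± w₀`; changing the sign of `w`
    -- moves every point to the first.
    rcases (hqp.dvd_or_dvd h1).resolve_left hκ |> hqp.dvd_or_dvd with h2 | h2
    · exact ⟨w, hwW, h2, hw⟩
    · refine ⟨-w, by rwa [abs_neg], ?_, by rw [hw]; ring⟩
      rw [show -w - w₀ = -(w + w₀) by ring]
      exact h2.neg_right
  · exact (Finset.card_le_univ _).trans (ZMod.card q).le

theorem exists_prime_sequence (Q : ℕ) (hQ : 1 ≤ Q) :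
    ∃ q : ℕ → ℕ, ∀ i, (q i).Prime ∧ 2 ^ i * Q < q i ∧ q i ≤ 2 ^ (i + 1) * Q := by
  have : ∀ i : ℕ, ∃ p, p.Prime ∧ 2 ^ i * Q < p ∧ p ≤ 2 ^ (i + 1) * Q := by
    intro i
    obtain ⟨p, hp, h1, h2⟩ := Nat.exists_prime_lt_and_le_two_mul (2 ^ i * Q) (by positivity)
    exact ⟨p, hp, h1, by rw [pow_succ]; linarith⟩
  choose q hq using this
  exact ⟨q, hq⟩

open Polynomial in
/-- Integral points with `|t| ≤ T` on a curve `κ w² = G(t)` with `G` of odd degree. -/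
theorem card_curve_points_le (G : ℤ[X]) (hG : Odd G.natDegree) (κ : ℤ) (k T W Q K V : ℕ)
    (hT : 1 ≤ T) (hk : 3 ≤ k) (hkQ : 4 * k < Q)
    (hWT : W * T ^ (k - 1) ≤ Q ^ (2 * k - 4)) (hW : 1 ≤ W) (hV : 2 * V < Q ^ K)
    (S : Finset ℤ)
    (hS : ∀ t ∈ S, |t| ≤ T ∧ G.eval t ≠ 0 ∧ |G.eval t| ≤ V ∧
      ∃ w : ℤ, |w| ≤ W ∧ G.eval t = κ * w ^ 2) :
    S.card ≤ K * ((G.natDegree + 2 * k) * (2 ^ K * Q)) := by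
  classical
  obtain ⟨q, hq⟩ := exists_prime_sequence Q (by omega)
  have hQq : ∀ i, Q ≤ q i := fun i =>
    (Nat.le_mul_of_pos_left Q (by positivity)).trans (hq i).2.1.le
  have hmono : StrictMono q := strictMono_nat_of_lt_succ fun i => (hq i).2.2.trans_lt (hq (i + 1)).2.1
  -- A nonzero `2 G(t)` of size below `Q ^ K` cannot be divisible by `K` distinct primes exceeding
  -- `Q`, so one of the primes is good for `t`.
  have hcover : S ⊆ (Finset.range K).biUnion
      fun i => S.filter fun t => ¬ (q i : ℤ) ∣ 2 * G.eval t := by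
    intro t ht
    obtain ⟨-, hne, hle, -⟩ := hS t ht
    by_contra hcon
    have hall : ∀ i ∈ Finset.range K, (q i : ℤ) ∣ 2 * G.eval t := by
      intro i hi
      by_contra h
      exact hcon (Finset.mem_biUnion.mpr ⟨i, hi, Finset.mem_filter.mpr ⟨ht, h⟩⟩)
    have h1 : (∏ i ∈ Finset.range K, (q i : ℤ)) ∣ 2 * G.eval t := by
      refine Finset.prod_dvd_of_coprime (fun i _ j _ hij => ?_) hall
      exact Nat.isCoprime_iff_coprime.mpr
        ((Nat.coprime_primes (hq i).1 (hq j).1).mpr (hmono.injective.ne hij))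
    have h2 := Int.le_of_dvd (abs_pos.mpr (mul_ne_zero two_ne_zero hne)) ((dvd_abs _ _).mpr h1)
    have h3 : ((Q : ℤ)) ^ K ≤ ∏ i ∈ Finset.range K, (q i : ℤ) := by
      have : Q ^ K ≤ ∏ i ∈ Finset.range K, q i := by
        simpa using Finset.prod_le_prod' (s := Finset.range K) (f := fun _ => Q) (g := q)
          fun i _ => hQq i
      exact_mod_cast this
    have h4 : (2 * V : ℤ) < (Q : ℤ) ^ K := by exact_mod_cast hV
    rw [abs_mul, abs_two] at h2
    linarith
  refine (Finset.card_le_card hcover).trans (Finset.card_biUnion_le.trans ?_)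
  refine (Finset.sum_le_card_nsmul _ _ ((G.natDegree + 2 * k) * (2 ^ K * Q)) fun i hi => ?_).trans
    (by simp)
  refine (card_curve_points_of_not_dvd_le G hG κ (q i) (hq i).1 k T W hT hk
    (hkQ.trans_le (hQq i)) (hWT.trans (Nat.pow_le_pow_left (hQq i) _)) hW _ ?_).trans ?_
  · intro t ht
    obtain ⟨htS, hnd⟩ := Finset.mem_filter.mp ht
    obtain ⟨h1, -, -, h2⟩ := hS t htS
    exact ⟨h1, hnd, h2⟩
  · refine Nat.mul_le_mul_left _ ((hq i).2.2.trans (Nat.mul_le_mul_right _ ?_))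
    exact Nat.pow_le_pow_right (by norm_num) (Finset.mem_range.mp hi)

/-! ### Covering lattice points by parallel lines -/

/-- A shortest nonzero vector of the lattice `{v : d ∣ v₁ z₀ - v₂ x₀}`. -/
theorem exists_shortest_vector (d : ℕ) (hd : 1 ≤ d) (x₀ z₀ : ℤ) :
    ∃ (e₁ e₂ : ℤ) (l : ℕ), 1 ≤ l ∧ l ^ 2 ≤ d ∧ max |e₁| |e₂| = l ∧
      (d : ℤ) ∣ e₁ * z₀ - e₂ * x₀ ∧
      ∀ v₁ v₂ : ℤ, (d : ℤ) ∣ v₁ * z₀ - v₂ * x₀ → v₁ * e₂ = v₂ * e₁ →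
        ∃ t, v₁ = t * e₁ ∧ v₂ = t * e₂ := by
  classical
  have : NeZero d := ⟨by omega⟩
  let P : ℕ → Prop := fun l => ∃ e₁ e₂ : ℤ, (e₁ ≠ 0 ∨ e₂ ≠ 0) ∧ max |e₁| |e₂| ≤ l ∧
    (d : ℤ) ∣ e₁ * z₀ - e₂ * x₀
  have hP : P (Nat.sqrt d) := by
    let s := Nat.sqrt d
    let box : Finset (ℤ × ℤ) := Finset.Icc 0 (s : ℤ) ×ˢ Finset.Icc 0 (s : ℤ)
    have hcard : (Finset.univ : Finset (ZMod d)).card < box.card := by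
      rw [Finset.card_univ, ZMod.card]
      simp only [box, Finset.card_product, Int.card_Icc]
      have := Nat.lt_succ_sqrt d
      simpa [s] using this
    obtain ⟨a, ha, b, hb, hne, hab⟩ := Finset.exists_ne_map_eq_of_card_lt_of_maps_to hcard
      (f := fun v : ℤ × ℤ => ((v.1 * z₀ - v.2 * x₀ : ℤ) : ZMod d))
      (fun _ _ => Finset.mem_coe.mpr (Finset.mem_univ _))
    simp only [box, Finset.mem_product, Finset.mem_Icc] at ha hb
    refine ⟨a.1 - b.1, a.2 - b.2, ?_, ?_, ?_⟩
    · by_contra hcon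
      push Not at hcon
      exact hne (Prod.ext (sub_eq_zero.mp hcon.1) (sub_eq_zero.mp hcon.2))
    · refine max_le (abs_le.mpr ?_) (abs_le.mpr ?_) <;> constructor <;> linarith
    · have := (ZMod.intCast_eq_intCast_iff_dvd_sub _ _ _).mp hab.symm
      convert this using 1
      ring
  have hex : ∃ l, P l := ⟨_, hP⟩
  obtain ⟨e₁, e₂, hne, hmax, hdvd⟩ := Nat.find_spec hex
  set l := Nat.find hex with hl
  have hmin : ∀ v₁ v₂ : ℤ, (d : ℤ) ∣ v₁ * z₀ - v₂ * x₀ → |v₁| < l → |v₂| < l →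
      v₁ = 0 ∧ v₂ = 0 := by
    intro v₁ v₂ hv h1 h2
    by_contra hcon
    obtain ⟨m, hm⟩ := Int.eq_ofNat_of_zero_le (a := max |v₁| |v₂|) (le_max_of_le_left (abs_nonneg _))
    have hml : m < l := by
      have : (m : ℤ) < l := by rw [← hm]; exact max_lt h1 h2
      exact_mod_cast this
    exact Nat.find_min hex hml ⟨v₁, v₂, by tauto, hm.le, hv⟩
  have hmaxeq : max |e₁| |e₂| = l := by
    refine le_antisymm hmax (not_lt.mp fun h => ?_)
    obtain ⟨h1, h2⟩ := max_lt_iff.mp h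
    have := hmin e₁ e₂ hdvd h1 h2
    tauto
  have hl1 : 1 ≤ l := by
    by_contra hcon
    have hl0 : l = 0 := by omega
    rw [hl0] at hmax
    have h1 := abs_nonpos_iff.mp ((le_max_left _ _).trans hmax)
    have h2 := abs_nonpos_iff.mp ((le_max_right _ _).trans hmax)
    tauto
  refine ⟨e₁, e₂, l, hl1, ?_, hmaxeq, hdvd, ?_⟩
  · have h1 : l ≤ Nat.sqrt d := Nat.find_min' hex hP
    exact (Nat.pow_le_pow_left h1 2).trans (by rw [sq]; exact Nat.sqrt_le d)
  · intro v₁ v₂ hv hpar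
    have hlpos : (0 : ℤ) < l := by exact_mod_cast hl1
    -- Divide with remainder in the dominant coordinate of `e`. The remainder vector is parallel to
    -- `e` and shorter than `l`, so it is zero by minimality.
    rcases max_choice |e₁| |e₂| with hc | hc
    · rw [hc] at hmaxeq
      have he : e₁ ≠ 0 := by rintro rfl; simp at hmaxeq; omega
      have he2 : |e₂| ≤ |e₁| := by rw [← hc]; exact le_max_right _ _
      refine ⟨v₁ / e₁, ?_⟩
      have hr := Int.mul_ediv_add_emod v₁ e₁
      have h1 : |v₁ - v₁ / e₁ * e₁| < l := by
        rw [show v₁ - v₁ / e₁ * e₁ = v₁ % e₁ by linarith, abs_of_nonneg (Int.emod_nonneg _ he),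
          ← hmaxeq]
        exact Int.emod_lt_abs v₁ he
      have h2 : |v₂ - v₁ / e₁ * e₂| ≤ |v₁ - v₁ / e₁ * e₁| := by
        have h3 : (v₂ - v₁ / e₁ * e₂) * e₁ = (v₁ - v₁ / e₁ * e₁) * e₂ := by
          linear_combination -hpar
        have h4 := congrArg abs h3
        rw [abs_mul, abs_mul] at h4
        refine le_of_mul_le_mul_right ?_ (abs_pos.mpr he)
        rw [h4]
        gcongr
      have := hmin (v₁ - v₁ / e₁ * e₁) (v₂ - v₁ / e₁ * e₂) ?_ h1 (h2.trans_lt h1)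
      · exact ⟨by linarith [this.1], by linarith [this.2]⟩
      · rw [show (v₁ - v₁ / e₁ * e₁) * z₀ - (v₂ - v₁ / e₁ * e₂) * x₀
          = (v₁ * z₀ - v₂ * x₀) - v₁ / e₁ * (e₁ * z₀ - e₂ * x₀) by ring]
        exact dvd_sub hv (hdvd.mul_left _)
    · rw [hc] at hmaxeq
      have he : e₂ ≠ 0 := by rintro rfl; simp at hmaxeq; omega
      have he2 : |e₁| ≤ |e₂| := by rw [← hc]; exact le_max_left _ _
      refine ⟨v₂ / e₂, ?_⟩
      have hr := Int.mul_ediv_add_emod v₂ e₂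
      have h1 : |v₂ - v₂ / e₂ * e₂| < l := by
        rw [show v₂ - v₂ / e₂ * e₂ = v₂ % e₂ by linarith, abs_of_nonneg (Int.emod_nonneg _ he),
          ← hmaxeq]
        exact Int.emod_lt_abs v₂ he
      have h2 : |v₁ - v₂ / e₂ * e₁| ≤ |v₂ - v₂ / e₂ * e₂| := by
        have h3 : (v₁ - v₂ / e₂ * e₁) * e₂ = (v₂ - v₂ / e₂ * e₂) * e₁ := by
          linear_combination hpar
        have h4 := congrArg abs h3
        rw [abs_mul, abs_mul] at h4
        refine le_of_mul_le_mul_right ?_ (abs_pos.mpr he)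
        rw [h4]
        gcongr
      have := hmin (v₁ - v₂ / e₂ * e₁) (v₂ - v₂ / e₂ * e₂) ?_ (h2.trans_lt h1) h1
      · exact ⟨by linarith [this.1], by linarith [this.2]⟩
      · rw [show (v₁ - v₂ / e₂ * e₁) * z₀ - (v₂ - v₂ / e₂ * e₂) * x₀
          = (v₁ * z₀ - v₂ * x₀) - v₂ / e₂ * (e₁ * z₀ - e₂ * x₀) by ring]
        exact dvd_sub hv (hdvd.mul_left _)

/-- Points of a box whose pairwise determinants are divisible by `d` lie on few lines. -/
theorem card_le_of_dvd_det (d X : ℕ) (hd : 1 ≤ d) (L : ℕ → ℕ) (S : Finset (ℤ × ℤ))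
    (hcop : ∀ u ∈ S, Int.gcd u.1 u.2 = 1) (hbox : ∀ u ∈ S, |u.1| ≤ X ∧ |u.2| ≤ X)
    (hdet : ∀ u ∈ S, ∀ v ∈ S, (d : ℤ) ∣ u.1 * v.2 - u.2 * v.1)
    (hL : ∀ (e₁ e₂ : ℤ) (l : ℕ), 1 ≤ l → l ^ 2 ≤ d → max |e₁| |e₂| = l → ∀ u ∈ S, ∀ S' ⊆ S,
      (∀ v ∈ S', ∃ t : ℤ, |t| * l ≤ 2 * X ∧ v = (u.1 + t * e₁, u.2 + t * e₂)) →
        S'.card ≤ L l) :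
    ∃ l : ℕ, 1 ≤ l ∧ l ^ 2 ≤ d ∧ S.card ≤ L l * (2 * (2 * X * l / d) + 1) := by
  classical
  rcases S.eq_empty_or_nonempty with rfl | ⟨u₀, hu₀⟩
  · exact ⟨1, le_rfl, by simpa using hd, by simp⟩
  obtain ⟨e₁, e₂, l, hl1, hld, hmax, hdvd, hpar⟩ := exists_shortest_vector d hd u₀.1 u₀.2
  refine ⟨l, hl1, hld, ?_⟩
  have hdpos : (0 : ℤ) < d := by exact_mod_cast hd
  have he1 : |e₁| ≤ l := by rw [← hmax]; exact le_max_left _ _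
  have he2 : |e₂| ≤ l := by rw [← hmax]; exact le_max_right _ _
  have hdete : ∀ u ∈ S, (d : ℤ) ∣ u.1 * e₂ - u.2 * e₁ := by
    intro u hu
    have h1 := hdet u hu u₀ hu₀
    obtain ⟨a, b, hab⟩ := Int.isCoprime_iff_gcd_eq_one.mpr (hcop u₀ hu₀)
    have h2 : (d : ℤ) ∣ (u.1 * e₂ - u.2 * e₁) * u₀.1 := by
      rw [show (u.1 * e₂ - u.2 * e₁) * u₀.1
        = (u.1 * u₀.2 - u.2 * u₀.1) * e₁ - (e₁ * u₀.2 - e₂ * u₀.1) * u.1 by ring]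
      exact dvd_sub (h1.mul_right _) (hdvd.mul_right _)
    have h3 : (d : ℤ) ∣ (u.1 * e₂ - u.2 * e₁) * u₀.2 := by
      rw [show (u.1 * e₂ - u.2 * e₁) * u₀.2
        = (u.1 * u₀.2 - u.2 * u₀.1) * e₂ - (e₁ * u₀.2 - e₂ * u₀.1) * u.2 by ring]
      exact dvd_sub (h1.mul_right _) (hdvd.mul_right _)
    rw [show u.1 * e₂ - u.2 * e₁ = a * ((u.1 * e₂ - u.2 * e₁) * u₀.1)
      + b * ((u.1 * e₂ - u.2 * e₁) * u₀.2) by linear_combination -(u.1 * e₂ - u.2 * e₁) * hab]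
    exact dvd_add (h2.mul_left _) (h3.mul_left _)
  -- The lines are indexed by `det(u, e) / d`, an integer of absolute value at most `2Xl/d`.
  refine (Finset.card_le_mul_card_image
    (f := fun u : ℤ × ℤ => (u.1 * e₂ - u.2 * e₁) / (d : ℤ)) S (L l) ?_).trans
    (Nat.mul_le_mul_left _ ?_)
  · intro j hj
    obtain ⟨u, hu, rfl⟩ := Finset.mem_image.mp hj
    refine hL e₁ e₂ l hl1 hld hmax u hu _ (Finset.filter_subset _ _) ?_
    intro v hv
    obtain ⟨hvS, hvj⟩ := Finset.mem_filter.mp hv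
    have h1 : v.1 * e₂ - v.2 * e₁ = u.1 * e₂ - u.2 * e₁ := by
      rw [← Int.ediv_mul_cancel (hdete v hvS), ← Int.ediv_mul_cancel (hdete u hu), hvj]
    obtain ⟨t, ht1, ht2⟩ := hpar (v.1 - u.1) (v.2 - u.2) (by
      rw [show (v.1 - u.1) * u₀.2 - (v.2 - u.2) * u₀.1
        = (v.1 * u₀.2 - v.2 * u₀.1) - (u.1 * u₀.2 - u.2 * u₀.1) by ring]
      exact dvd_sub (hdet v hvS u₀ hu₀) (hdet u hu u₀ hu₀)) (by linear_combination h1)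
    refine ⟨t, ?_, Prod.ext (by simp; linarith) (by simp; linarith)⟩
    have hb1 := hbox v hvS
    have hb2 := hbox u hu
    rcases max_choice |e₁| |e₂| with hc | hc
    · rw [← hmax, hc, ← abs_mul, ← ht1]
      exact (abs_sub _ _).trans (by linarith)
    · rw [← hmax, hc, ← abs_mul, ← ht2]
      exact (abs_sub _ _).trans (by linarith)
  · have hsub : S.image (fun u : ℤ × ℤ => (u.1 * e₂ - u.2 * e₁) / (d : ℤ))
        ⊆ Finset.Icc (-((2 * X * l / d : ℕ) : ℤ)) ((2 * X * l / d : ℕ) : ℤ) := by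
      intro j hj
      obtain ⟨u, hu, rfl⟩ := Finset.mem_image.mp hj
      obtain ⟨j, hj⟩ := hdete u hu
      rw [hj, Int.mul_ediv_cancel_left _ hdpos.ne', Finset.mem_Icc, ← abs_le]
      push_cast
      rw [Int.le_ediv_iff_mul_le hdpos, ← Int.natAbs_natCast d, ← Int.abs_eq_natAbs, ← abs_mul,
        mul_comm, ← hj]
      have hb := hbox u hu
      calc |u.1 * e₂ - u.2 * e₁| ≤ |u.1 * e₂| + |u.2 * e₁| := abs_sub _ _
        _ = |u.1| * |e₂| + |u.2| * |e₁| := by rw [abs_mul, abs_mul]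
        _ ≤ X * l + X * l := by
            gcongr
            · exact hb.1
            · exact hb.2
        _ = 2 * X * l := by ring
    refine (Finset.card_le_card hsub).trans ?_
    rw [Int.card_Icc]
    omega

/-! ### Binary quintic forms and their restrictions to lines -/

open Polynomial in
/-- The binary quintic form `∑ Fᵢ xⁱ z⁵⁻ⁱ` attached to a polynomial `F`. -/
def quinticForm (F : ℤ[X]) (x z : ℤ) : ℤ :=
  ∑ i ∈ Finset.range 6, F.coeff i * x ^ i * z ^ (5 - i)

open Polynomial in
theorem quinticForm_cast {K : Type*} [Field K] (F : ℤ[X]) (hF : F.natDegree ≤ 5) (x z : ℤ)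
    (hz : (z : K) ≠ 0) :
    ((quinticForm F x z : ℤ) : K)
      = (z : K) ^ 5 * (F.map (Int.castRingHom K)).eval ((x : K) / z) := by
  rw [eval_eq_sum_range' (n := 6) (lt_of_le_of_lt natDegree_map_le (by omega)), Finset.mul_sum,
    quinticForm, Int.cast_sum]
  refine Finset.sum_congr rfl fun i hi => ?_
  have h5 : (z : K) ^ 5 = z ^ i * z ^ (5 - i) := by
    rw [← pow_add]
    congr 1
    have := Finset.mem_range.mp hi
    omega
  rw [h5, coeff_map, div_pow]
  push_cast
  simp only [eq_intCast]
  field_simp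

open Polynomial in
theorem quinticForm_mul_self (F : ℤ[X]) (hF : F.natDegree ≤ 5) (r z : ℤ) :
    quinticForm F (r * z) z = z ^ 5 * F.eval r := by
  rw [eval_eq_sum_range' (n := 6) (by omega), Finset.mul_sum, quinticForm]
  refine Finset.sum_congr rfl fun i hi => ?_
  have h5 : z ^ 5 = z ^ i * z ^ (5 - i) := by
    rw [← pow_add]
    congr 1
    have := Finset.mem_range.mp hi
    omega
  rw [h5, mul_pow]
  ring

open Polynomial in
theorem sub_dvd_quinticForm_sub (F : ℤ[X]) (x y z : ℤ) :
    x - y ∣ quinticForm F x z - quinticForm F y z := by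
  rw [quinticForm, quinticForm, ← Finset.sum_sub_distrib]
  refine Finset.dvd_sum fun i _ => ?_
  rw [show F.coeff i * x ^ i * z ^ (5 - i) - F.coeff i * y ^ i * z ^ (5 - i)
    = (x ^ i - y ^ i) * (F.coeff i * z ^ (5 - i)) by ring]
  exact (sub_dvd_pow_sub_pow x y i).mul_right _

open Polynomial in
theorem abs_quinticForm_le (F : ℤ[X]) (X : ℤ) (x z : ℤ) (hx : |x| ≤ X) (hz : |z| ≤ X) :
    |quinticForm F x z| ≤ (∑ i ∈ Finset.range 6, |F.coeff i|) * X ^ 5 := by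
  have hX : 0 ≤ X := (abs_nonneg x).trans hx
  rw [quinticForm, Finset.sum_mul]
  refine (Finset.abs_sum_le_sum_abs _ _).trans (Finset.sum_le_sum fun i hi => ?_)
  rw [abs_mul, abs_mul, abs_pow, abs_pow, mul_assoc]
  have h5 : X ^ 5 = X ^ i * X ^ (5 - i) := by
    rw [← pow_add]
    congr 1
    have := Finset.mem_range.mp hi
    omega
  rw [h5]
  gcongr

open Polynomial in
/-- The restriction of a quintic form to the line `u + t e`. -/
noncomputable def linePolynomial (F : ℤ[X]) (u₁ u₂ e₁ e₂ : ℤ) : ℤ[X] :=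
  ∑ i ∈ Finset.range 6,
    C (F.coeff i) * (C u₁ + C e₁ * X) ^ i * (C u₂ + C e₂ * X) ^ (5 - i)

open Polynomial in
theorem eval_linePolynomial (F : ℤ[X]) (u₁ u₂ e₁ e₂ t : ℤ) :
    (linePolynomial F u₁ u₂ e₁ e₂).eval t = quinticForm F (u₁ + t * e₁) (u₂ + t * e₂) := by
  simp only [linePolynomial, quinticForm, eval_finsetSum, eval_mul, eval_pow, eval_add, eval_C,
    eval_X, mul_comm t]

-- The coefficient of `t⁵` is the value of the form at the direction `(e₁, e₂)`.
open Polynomial in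
theorem natDegree_linePolynomial (F : ℤ[X]) (u₁ u₂ e₁ e₂ : ℤ) (he : quinticForm F e₁ e₂ ≠ 0) :
    (linePolynomial F u₁ u₂ e₁ e₂).natDegree = 5 := by
  have hlin : ∀ a b : ℤ, (C a + C b * X : ℤ[X]).natDegree ≤ 1 := by
    intro a b
    rw [add_comm]
    exact natDegree_linear_le
  have hlc : ∀ a b : ℤ, (C a + C b * X : ℤ[X]).coeff 1 = b := by
    intro a b
    rw [coeff_add, coeff_C_mul, coeff_X_one, coeff_C_succ, zero_add, mul_one]
  have hpow : ∀ (a b : ℤ) (i : ℕ), ((C a + C b * X : ℤ[X]) ^ i).natDegree ≤ i := by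
    intro a b i
    simpa using natDegree_pow_le_of_le i (hlin a b)
  have hpc : ∀ (a b : ℤ) (i : ℕ), ((C a + C b * X : ℤ[X]) ^ i).coeff i = b ^ i := by
    intro a b i
    have := coeff_pow_of_natDegree_le (m := i) (hlin a b)
    rw [mul_one, hlc] at this
    exact this
  refine natDegree_eq_of_le_of_coeff_ne_zero ?_ ?_
  · refine natDegree_sum_le_of_forall_le _ _ fun i hi => ?_
    have h6 := Finset.mem_range.mp hi
    refine natDegree_mul_le.trans ?_
    have h1 := (natDegree_C_mul_le (F.coeff i) ((C u₁ + C e₁ * X) ^ i)).trans (hpow u₁ e₁ i)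
    have h2 := hpow u₂ e₂ (5 - i)
    omega
  · convert he using 1
    rw [linePolynomial, finsetSum_coeff, quinticForm]
    refine Finset.sum_congr rfl fun i hi => ?_
    have h6 := Finset.mem_range.mp hi
    rw [mul_assoc, coeff_C_mul, mul_assoc]
    congr 1
    have := coeff_mul_add_eq_of_natDegree_le (hpow u₁ e₁ i) (hpow u₂ e₂ (5 - i))
    rw [show i + (5 - i) = 5 by omega] at this
    rw [this, hpc, hpc]

/-! ### Zeros modulo `p` and `p²`; medium primes -/

open Polynomial in
theorem not_dvd_of_dvd_quinticForm (F : ℤ[X]) (p : ℕ) (hp : p.Prime)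
    (hc : ¬ (p : ℤ) ∣ F.coeff 5) (x z : ℤ) (hxz : Int.gcd x z = 1)
    (h : (p : ℤ) ∣ quinticForm F x z) : ¬ (p : ℤ) ∣ z := by
  intro hz
  have hpp : Prime (p : ℤ) := Nat.prime_iff_prime_int.mp hp
  have h1 : (p : ℤ) ∣ F.coeff 5 * x ^ 5 := by
    rw [quinticForm, Finset.sum_range_succ] at h
    have h2 : (p : ℤ) ∣ ∑ i ∈ Finset.range 5, F.coeff i * x ^ i * z ^ (5 - i) := by
      refine Finset.dvd_sum fun i hi => (hz.trans (dvd_pow_self z ?_)).mul_left _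
      have := Finset.mem_range.mp hi
      omega
    have h3 := (dvd_add_right h2).mp h
    simpa using h3
  have hx : (p : ℤ) ∣ x := hpp.dvd_of_dvd_pow ((hpp.dvd_or_dvd h1).resolve_left hc)
  have := Int.dvd_coe_gcd hx hz
  rw [hxz] at this
  exact hpp.not_isUnit (isUnit_of_dvd_one (by simpa using this))

open Polynomial in
theorem rootSet_card_le_five (F : ℤ[X]) (hF : F.natDegree ≤ 5) (K : Type*) [Field K]
    [DecidableEq K] : ((F.map (Int.castRingHom K)).roots.toFinset).card ≤ 5 :=
  (Multiset.toFinset_card_le _).trans ((card_roots' _).trans (natDegree_map_le.trans hF))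

open Polynomial in
/-- The slope of a point at which the form vanishes modulo `p` is a root modulo `p`. -/
theorem slope_mem_roots (F : ℤ[X]) (hF : F.natDegree ≤ 5) (p : ℕ) [Fact p.Prime]
    (hc : ¬ (p : ℤ) ∣ F.coeff 5) (x z : ℤ) (hxz : Int.gcd x z = 1)
    (h : (p : ℤ) ∣ quinticForm F x z) :
    (z : ZMod p) ≠ 0 ∧
      (x / z : ZMod p) ∈ (F.map (Int.castRingHom (ZMod p))).roots.toFinset := by
  have hz : (z : ZMod p) ≠ 0 := fun h0 =>
    not_dvd_of_dvd_quinticForm F p Fact.out hc x z hxz h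
      ((ZMod.intCast_zmod_eq_zero_iff_dvd z p).mp h0)
  refine ⟨hz, ?_⟩
  have hne : F.map (Int.castRingHom (ZMod p)) ≠ 0 := by
    intro h0
    have := congrArg (fun P => P.coeff 5) h0
    simp only [coeff_map, eq_intCast, coeff_zero] at this
    exact hc ((ZMod.intCast_zmod_eq_zero_iff_dvd _ p).mp this)
  rw [Multiset.mem_toFinset, mem_roots hne, IsRoot.def]
  have h1 := quinticForm_cast F hF x z hz
  rw [(ZMod.intCast_zmod_eq_zero_iff_dvd _ p).mpr h] at h1
  exact (mul_eq_zero.mp h1.symm).resolve_left (pow_ne_zero 5 hz)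

theorem dvd_det_of_slope_eq (p : ℕ) [Fact p.Prime] (x₁ z₁ x₂ z₂ : ℤ) (h₁ : (z₁ : ZMod p) ≠ 0)
    (h₂ : (z₂ : ZMod p) ≠ 0) (h : (x₁ / z₁ : ZMod p) = x₂ / z₂) :
    (p : ℤ) ∣ x₁ * z₂ - z₁ * x₂ := by
  rw [div_eq_div_iff h₁ h₂] at h
  rw [← ZMod.intCast_zmod_eq_zero_iff_dvd]
  push_cast
  rw [h]
  ring

open Polynomial in
/-- Hensel's lemma for a pair of zeros of a binary form modulo `p ^ 2`. -/
theorem sq_dvd_det_of_dvd_det (F A B : ℤ[X]) (D : ℤ) (hF : F.natDegree ≤ 5)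
    (hAB : A * F + B * derivative F = C D) (p : ℕ) (hp : p.Prime) (hD : ¬ (p : ℤ) ∣ D)
    (x₁ z₁ x₂ z₂ : ℤ) (hz₁ : ¬ (p : ℤ) ∣ z₁) (hz₂ : ¬ (p : ℤ) ∣ z₂)
    (h₁ : (p : ℤ) ^ 2 ∣ quinticForm F x₁ z₁) (h₂ : (p : ℤ) ^ 2 ∣ quinticForm F x₂ z₂)
    (h : (p : ℤ) ∣ x₁ * z₂ - z₁ * x₂) : (p : ℤ) ^ 2 ∣ x₁ * z₂ - z₁ * x₂ := by
  have hpp : Prime (p : ℤ) := Nat.prime_iff_prime_int.mp hp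
  -- The slope `r ≡ x / z` modulo `p²` is a root of `F` modulo `p²`, since `f(rz, z) = z⁵ F(r)`.
  have key : ∀ x z : ℤ, ¬ (p : ℤ) ∣ z → (p : ℤ) ^ 2 ∣ quinticForm F x z →
      ∃ r : ℤ, (p : ℤ) ^ 2 ∣ x - r * z ∧ (p : ℤ) ^ 2 ∣ F.eval r := by
    intro x z hz hf
    have hcop : IsCoprime z ((p : ℤ) ^ 2) := (hpp.coprime_iff_not_dvd.mpr hz).symm.pow_right
    obtain ⟨a, b, hab⟩ := hcop
    have hx : (p : ℤ) ^ 2 ∣ x - x * a * z := ⟨x * b, by linear_combination -x * hab⟩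
    refine ⟨x * a, hx, ?_⟩
    have h3 := hx.trans (sub_dvd_quinticForm_sub F x (x * a * z) z)
    rw [quinticForm_mul_self F hF] at h3
    have h4 := (dvd_sub_right hf).mp h3
    exact (IsCoprime.pow_right (n := 5) ⟨b, a, by linear_combination hab⟩).dvd_of_dvd_mul_left h4
  obtain ⟨r₁, hx₁, hr₁⟩ := key x₁ z₁ hz₁ h₁
  obtain ⟨r₂, hx₂, hr₂⟩ := key x₂ z₂ hz₂ h₂
  have hpsq : (p : ℤ) ∣ (p : ℤ) ^ 2 := dvd_pow_self _ two_ne_zero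
  have e : x₁ * z₂ - z₁ * x₂
      = (x₁ - r₁ * z₁) * z₂ - (x₂ - r₂ * z₂) * z₁ - (r₂ - r₁) * (z₁ * z₂) := by ring
  have hpr : (p : ℤ) ∣ r₂ - r₁ := by
    have h5 : (p : ℤ) ∣ (r₂ - r₁) * (z₁ * z₂) := by
      refine (dvd_sub_right (dvd_sub ((hpsq.trans hx₁).mul_right z₂)
        ((hpsq.trans hx₂).mul_right z₁))).mp ?_
      rwa [← e]
    refine (hpp.dvd_or_dvd h5).resolve_right fun h6 => ?_
    exact (hpp.dvd_or_dvd h6).elim hz₁ hz₂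
  have hder : ¬ (p : ℤ) ∣ (derivative F).eval r₁ := by
    intro h6
    apply hD
    have h7 := congrArg (eval r₁) hAB
    simp only [eval_add, eval_mul, eval_C] at h7
    rw [← h7]
    exact dvd_add ((hpsq.trans hr₁).mul_left _) (h6.mul_left _)
  -- Taylor expansion at `r₁`: the quadratic term is already divisible by `p²`, and `F'(r₁)` is a
  -- unit modulo `p`.
  have hpr2 : (p : ℤ) ^ 2 ∣ r₂ - r₁ := by
    obtain ⟨c, hc⟩ := binomExpansion F r₁ (r₂ - r₁)
    rw [add_sub_cancel] at hc
    have h8 : (p : ℤ) ^ 2 ∣ (derivative F).eval r₁ * (r₂ - r₁) := by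
      rw [show (derivative F).eval r₁ * (r₂ - r₁)
        = F.eval r₂ - F.eval r₁ - c * (r₂ - r₁) ^ 2 by linear_combination -hc]
      exact dvd_sub (dvd_sub hr₂ hr₁) ((pow_dvd_pow_of_dvd hpr 2).mul_left _)
    exact ((hpp.coprime_iff_not_dvd.mpr hder).pow_left).dvd_of_dvd_mul_left h8
  rw [e]
  exact dvd_sub (dvd_sub (hx₁.mul_right _) (hx₂.mul_right _)) (hpr2.mul_right _)

theorem eq_or_eq_neg_of_det_eq_zero (u v : ℤ × ℤ) (hu : Int.gcd u.1 u.2 = 1)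
    (hv : Int.gcd v.1 v.2 = 1) (h : u.1 * v.2 - u.2 * v.1 = 0) : v = u ∨ v = -u := by
  obtain ⟨a, b, hab⟩ := Int.isCoprime_iff_gcd_eq_one.mpr hu
  obtain ⟨c, d, hcd⟩ := Int.isCoprime_iff_gcd_eq_one.mpr hv
  have h1 : v.1 = (a * v.1 + b * v.2) * u.1 := by linear_combination -v.1 * hab - b * h
  have h2 : v.2 = (a * v.1 + b * v.2) * u.2 := by linear_combination -v.2 * hab + a * h
  have h3 : (a * v.1 + b * v.2) * (c * u.1 + d * u.2) = 1 := by
    linear_combination hcd - c * h1 - d * h2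
  rcases Int.isUnit_iff.mp (IsUnit.of_mul_eq_one _ h3) with h4 | h4
  · left
    rw [h4] at h1 h2
    exact Prod.ext (by linarith) (by linarith)
  · right
    rw [h4] at h1 h2
    exact Prod.ext (by simp; linarith) (by simp; linarith)

-- The sign condition makes both terms of the determinant have the same sign, so it is bounded by
-- `N²` and not merely `2N²`; this is what `p > N` needs. Each of the at most five slopes then
-- carries one pair `± u`.
open Polynomial in
theorem card_sq_dvd_of_sign_le (F A B : ℤ[X]) (D : ℤ) (hF : F.natDegree ≤ 5)
    (hAB : A * F + B * derivative F = C D) (p N : ℕ) (hp : p.Prime) (hD : ¬ (p : ℤ) ∣ D)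
    (hc : ¬ (p : ℤ) ∣ F.coeff 5) (hN : N < p) (S : Finset (ℤ × ℤ))
    (hS : ∀ u ∈ S, |u.1| ≤ N ∧ |u.2| ≤ N ∧ Int.gcd u.1 u.2 = 1 ∧
      (p : ℤ) ^ 2 ∣ quinticForm F u.1 u.2)
    (hsign : ∀ u ∈ S, ∀ v ∈ S, 0 ≤ (u.1 * v.2) * (u.2 * v.1)) : S.card ≤ 2 * 5 := by
  classical
  have : Fact p.Prime := ⟨hp⟩
  have hpsq : (p : ℤ) ∣ (p : ℤ) ^ 2 := dvd_pow_self _ two_ne_zero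
  refine (Finset.card_le_mul_card_image (f := fun u : ℤ × ℤ => (u.1 / u.2 : ZMod p)) S 2 ?_).trans
    (Nat.mul_le_mul_left _ ((Finset.card_le_card ?_).trans (rootSet_card_le_five F hF (ZMod p))))
  · intro c hcc
    obtain ⟨u, hu, rfl⟩ := Finset.mem_image.mp hcc
    obtain ⟨hu1, hu2, hug, hud⟩ := hS u hu
    refine (Finset.card_le_card (t := {u, -u}) fun v hv => ?_).trans Finset.card_le_two
    obtain ⟨hvS, hvc⟩ := Finset.mem_filter.mp hv
    obtain ⟨hv1, hv2, hvg, hvd⟩ := hS v hvS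
    have hzu := slope_mem_roots F hF p hc u.1 u.2 hug (hpsq.trans hud)
    have hzv := slope_mem_roots F hF p hc v.1 v.2 hvg (hpsq.trans hvd)
    have hdet := sq_dvd_det_of_dvd_det F A B D hF hAB p hp hD u.1 u.2 v.1 v.2
      (fun h => hzu.1 ((ZMod.intCast_zmod_eq_zero_iff_dvd _ p).mpr h))
      (fun h => hzv.1 ((ZMod.intCast_zmod_eq_zero_iff_dvd _ p).mpr h)) hud hvd
      (dvd_det_of_slope_eq p _ _ _ _ hzu.1 hzv.1 hvc.symm)
    have hb1 : |u.1 * v.2| ≤ (N : ℤ) ^ 2 := by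
      rw [abs_mul, sq]
      gcongr
    have hb2 : |u.2 * v.1| ≤ (N : ℤ) ^ 2 := by
      rw [abs_mul, sq]
      gcongr
    have hlt : |u.1 * v.2 - u.2 * v.1| < (p : ℤ) ^ 2 := by
      have h1 : |u.1 * v.2 - u.2 * v.1| ≤ (N : ℤ) ^ 2 := by
        have hs := hsign u hu v hvS
        rw [abs_le] at hb1 hb2 ⊢
        rcases mul_nonneg_iff.mp hs with h | h <;> constructor <;> linarith [h.1, h.2]
      refine h1.trans_lt ?_
      have : (N : ℤ) < p := by exact_mod_cast hN
      gcongr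
    have := eq_or_eq_neg_of_det_eq_zero u v hug hvg (Int.eq_zero_of_abs_lt_dvd hdet hlt)
    simpa using this
  · intro c hcc
    obtain ⟨u, hu, rfl⟩ := Finset.mem_image.mp hcc
    obtain ⟨hu1, hu2, hug, hud⟩ := hS u hu
    exact (slope_mem_roots F hF p hc u.1 u.2 hug (hpsq.trans hud)).2

open Polynomial in
theorem card_sq_dvd_le (F A B : ℤ[X]) (D : ℤ) (hF : F.natDegree ≤ 5)
    (hAB : A * F + B * derivative F = C D) (p N : ℕ) (hp : p.Prime) (hD : ¬ (p : ℤ) ∣ D)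
    (hc : ¬ (p : ℤ) ∣ F.coeff 5) (hN : N < p) (S : Finset (ℤ × ℤ))
    (hS : ∀ u ∈ S, |u.1| ≤ N ∧ |u.2| ≤ N ∧ Int.gcd u.1 u.2 = 1 ∧
      (p : ℤ) ^ 2 ∣ quinticForm F u.1 u.2) : S.card ≤ 20 := by
  classical
  rw [← Finset.card_filter_add_card_filter_not (s := S) (fun u : ℤ × ℤ => 0 ≤ u.1 * u.2)]
  have h1 := card_sq_dvd_of_sign_le F A B D hF hAB p N hp hD hc hN
    (S.filter fun u => 0 ≤ u.1 * u.2) (fun u hu => hS u (Finset.mem_filter.mp hu).1)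
    (fun u hu v hv => by
      have := mul_nonneg (Finset.mem_filter.mp hu).2 (Finset.mem_filter.mp hv).2
      linarith)
  have h2 := card_sq_dvd_of_sign_le F A B D hF hAB p N hp hD hc hN
    (S.filter fun u => ¬ 0 ≤ u.1 * u.2) (fun u hu => hS u (Finset.mem_filter.mp hu).1)
    (fun u hu v hv => by
      have h3 := (Finset.mem_filter.mp hu).2
      have h4 := (Finset.mem_filter.mp hv).2
      push Not at h3 h4
      have := mul_pos_of_neg_of_neg h3 h4
      linarith)
  omega

open Polynomial in
/-- The pairs for which the square of a prime in `(N, P]` divides the form. -/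
theorem card_medium_primes_le (F A B : ℤ[X]) (D : ℤ) (hF : F.natDegree ≤ 5)
    (hAB : A * F + B * derivative F = C D) (hD : D ≠ 0) (hc : F.coeff 5 ≠ 0) (N P : ℕ)
    (hN : |D| + |F.coeff 5| ≤ N) (S : Finset (ℤ × ℤ))
    (hS : ∀ u ∈ S, |u.1| ≤ N ∧ |u.2| ≤ N ∧ Int.gcd u.1 u.2 = 1 ∧
      ∃ p : ℕ, p.Prime ∧ N < p ∧ p ≤ P ∧ (p : ℤ) ^ 2 ∣ quinticForm F u.1 u.2) :
    S.card ≤ 20 * P := by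
  classical
  have hcover : S ⊆ ((Finset.Icc 1 P).filter fun p => p.Prime ∧ N < p).biUnion
      fun p => S.filter fun u => (p : ℤ) ^ 2 ∣ quinticForm F u.1 u.2 := by
    intro u hu
    obtain ⟨-, -, -, p, hp, hNp, hpP, hd⟩ := hS u hu
    exact Finset.mem_biUnion.mpr ⟨p, Finset.mem_filter.mpr
      ⟨Finset.mem_Icc.mpr ⟨hp.one_lt.le, hpP⟩, hp, hNp⟩, Finset.mem_filter.mpr ⟨hu, hd⟩⟩
  refine (Finset.card_le_card hcover).trans (Finset.card_biUnion_le.trans ?_)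
  refine (Finset.sum_le_card_nsmul _ _ 20 fun p hp => ?_).trans ?_
  · obtain ⟨-, hpp, hNp⟩ := Finset.mem_filter.mp hp
    have hbig : |D| + |F.coeff 5| < p := hN.trans_lt (by exact_mod_cast hNp)
    refine card_sq_dvd_le F A B D hF hAB p N hpp (fun h => hD ?_) (fun h => hc ?_) hNp _ ?_
    · exact Int.eq_zero_of_abs_lt_dvd h (by linarith [abs_nonneg (F.coeff 5)])
    · exact Int.eq_zero_of_abs_lt_dvd h (by linarith [abs_nonneg D])
    · intro u hu
      obtain ⟨huS, hd⟩ := Finset.mem_filter.mp hu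
      obtain ⟨h1, h2, h3, -⟩ := hS u huS
      exact ⟨h1, h2, h3, hd⟩
  · rw [smul_eq_mul, mul_comm]
    refine Nat.mul_le_mul_left _ ((Finset.card_filter_le _ _).trans ?_)
    simp

/-! ### Consequences of irreducibility -/

open Polynomial in
theorem not_isUnit_of_isHomogeneous (f : MvPolynomial (Fin 2) ℚ) (n : ℕ) (hn : n ≠ 0)
    (hf : f.IsHomogeneous n) : ¬ IsUnit f := by
  intro h
  have h1 := h.map (MvPolynomial.constantCoeff (σ := Fin 2) (R := ℚ))
  rw [MvPolynomial.constantCoeff_eq, hf.coeff_eq_zero (by simpa using hn.symm)] at h1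
  exact not_isUnit_zero h1

-- If the top coefficient vanished, the second variable, which is the homogenization of `1` in
-- degree 1, would split off as a factor.
open Polynomial in
theorem coeff_ne_zero_of_irreducible_homogenize (P : ℚ[X]) (n : ℕ) (hn : 2 ≤ n)
    (hP : P.natDegree ≤ n) (hirr : Irreducible (P.homogenize n)) : P.coeff n ≠ 0 := by
  intro h0
  obtain ⟨m, rfl⟩ : ∃ m, n = m + 1 := ⟨n - 1, by omega⟩
  have hdeg : P.natDegree ≤ m := by
    by_contra hcon
    have h1 : P.natDegree = m + 1 := by omega
    have h2 : P.leadingCoeff = 0 := by rw [leadingCoeff, h1, h0]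
    rw [leadingCoeff_eq_zero.mp h2] at h1
    simp at h1
  have h3 := homogenize_mul P 1 (m := m) (n := 1) hdeg (by simp)
  rw [mul_one] at h3
  rcases hirr.isUnit_or_isUnit h3 with h | h
  · exact not_isUnit_of_isHomogeneous _ m (by omega) (isHomogeneous_homogenize P) h
  · exact not_isUnit_of_isHomogeneous _ 1 one_ne_zero (isHomogeneous_homogenize 1) h

open Polynomial in
theorem irreducible_of_irreducible_homogenize (P : ℚ[X]) (n : ℕ) (hn : n ≠ 0)
    (hP : P.natDegree = n) (hirr : Irreducible (P.homogenize n)) : Irreducible P := by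
  have hP0 : P ≠ 0 := by rintro rfl; simp at hP; omega
  refine ⟨fun h => hn (by rw [← hP, natDegree_eq_zero_of_isUnit h]), fun {A B} hAB => ?_⟩
  have hA0 : A ≠ 0 := by rintro rfl; simp at hAB; exact hP0 hAB
  have hB0 : B ≠ 0 := by rintro rfl; simp at hAB; exact hP0 hAB
  have hunit : ∀ Q : ℚ[X], Q ≠ 0 → IsUnit (Q.homogenize Q.natDegree) → IsUnit Q := by
    intro Q hQ0 hQ
    by_contra hcon
    refine not_isUnit_of_isHomogeneous _ Q.natDegree (fun h0 => hcon ?_)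
      (isHomogeneous_homogenize Q) hQ
    rw [eq_C_of_natDegree_eq_zero h0]
    refine isUnit_C.mpr (isUnit_iff_ne_zero.mpr fun h1 => hQ0 ?_)
    rw [eq_C_of_natDegree_eq_zero h0, h1, C_0]
  have h1 := homogenize_mul A B le_rfl le_rfl
  rw [← natDegree_mul hA0 hB0, ← hAB, hP] at h1
  exact (hirr.isUnit_or_isUnit h1).imp (hunit A hA0) (hunit B hB0)

-- Irreducible polynomials over `ℚ` are separable; clearing denominators in the Bézout identity
-- gives `D`, which serves as a discriminant.
open Polynomial in
theorem exists_bezout_derivative (F : ℤ[X]) (hF : Irreducible (F.map (Int.castRingHom ℚ))) :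
    ∃ (A B : ℤ[X]) (D : ℤ), D ≠ 0 ∧ A * F + B * derivative F = C D := by
  obtain ⟨a, b, hab⟩ := hF.separable
  obtain ⟨m, hm0, hm⟩ := IsLocalization.integerNormalization_spec (nonZeroDivisors ℤ) a
  obtain ⟨n, hn0, hn⟩ := IsLocalization.integerNormalization_spec (nonZeroDivisors ℤ) b
  set a' := IsLocalization.integerNormalization (nonZeroDivisors ℤ) a
  set b' := IsLocalization.integerNormalization (nonZeroDivisors ℤ) b
  refine ⟨C n * a', C m * b', m * n,
    mul_ne_zero (nonZeroDivisors.ne_zero hm0) (nonZeroDivisors.ne_zero hn0), ?_⟩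
  apply map_injective (Int.castRingHom ℚ) Int.cast_injective
  rw [algebraMap_int_eq, zsmul_eq_mul] at hm hn
  simp only [Polynomial.map_add, Polynomial.map_mul, Polynomial.map_intCast, hm, hn, eq_intCast,
    Int.cast_mul]
  rw [derivative_map] at hab
  linear_combination ((m : ℚ[X]) * (n : ℚ[X])) * hab

open Polynomial in
theorem quinticForm_ne_zero (F : ℤ[X]) (hdeg : F.natDegree ≤ 5) (h5 : F.coeff 5 ≠ 0)
    (hF : Irreducible (F.map (Int.castRingHom ℚ))) (x z : ℤ) (hxz : x ≠ 0 ∨ z ≠ 0) :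
    quinticForm F x z ≠ 0 := by
  intro h0
  by_cases hz : z = 0
  · subst hz
    rw [quinticForm, Finset.sum_range_succ, Finset.sum_eq_zero] at h0
    · simp [h5] at h0
      tauto
    · intro i hi
      have := Finset.mem_range.mp hi
      rw [zero_pow (by omega), mul_zero]
  · have hz' : (z : ℚ) ≠ 0 := by exact_mod_cast hz
    have h1 := quinticForm_cast (K := ℚ) F hdeg x z hz'
    rw [h0, Int.cast_zero] at h1
    have h2 := (mul_eq_zero.mp h1.symm).resolve_left (pow_ne_zero 5 hz')
    have h3 := natDegree_eq_of_degree_eq_some (n := 1) (degree_eq_one_of_irreducible_of_root hF h2)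
    have h4 := le_natDegree_of_ne_zero (n := 5) (p := F.map (Int.castRingHom ℚ)) (by simpa using h5)
    omega

open Polynomial in
theorem eval_homogenize_five (F : ℤ[X]) (x z : ℤ) :
    MvPolynomial.eval ![x, z] (F.homogenize 5) = quinticForm F x z := by
  simp [homogenize, quinticForm, MvPolynomial.eval_monomial,
    Finset.Nat.sum_antidiagonal_eq_sum_range_succ_mk, Finsupp.prod_fintype, mul_assoc]

open Polynomial in
/-- Dehomogenization of a quintic form that is irreducible over `ℚ`. -/
theorem exists_dehomogenization (f : MvPolynomial (Fin 2) ℤ) (hhom : f.IsHomogeneous 5)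
    (hirr : Irreducible (MvPolynomial.map (Int.castRingHom ℚ) f)) :
    ∃ (F A B : ℤ[X]) (D : ℤ), F.natDegree ≤ 5 ∧ F.coeff 5 ≠ 0 ∧ D ≠ 0 ∧
      A * F + B * derivative F = C D ∧
      (∀ x z : ℤ, x ≠ 0 ∨ z ≠ 0 → quinticForm F x z ≠ 0) ∧
      ∀ x z : ℤ, MvPolynomial.eval ![x, z] f = quinticForm F x z := by
  set F : ℤ[X] := MvPolynomial.aeval ![X, 1] f with hFdef
  have hf : F.homogenize 5 = f := homogenize_eq_of_isHomogeneous hhom rfl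
  have hdeg : F.natDegree ≤ 5 := by
    have := MvPolynomial.aeval_natDegree_le f hhom.totalDegree_le (![X, 1] : Fin 2 → ℤ[X])
      (n := 1) (by intro i; fin_cases i <;> simp)
    simpa using this
  have hdeg' : (F.map (Int.castRingHom ℚ)).natDegree ≤ 5 := natDegree_map_le.trans hdeg
  rw [← hf, ← homogenize_map] at hirr
  have hc' := coeff_ne_zero_of_irreducible_homogenize _ 5 (by norm_num) hdeg' hirr
  have hF : Irreducible (F.map (Int.castRingHom ℚ)) :=
    irreducible_of_irreducible_homogenize _ 5 (by norm_num)
      (natDegree_eq_of_le_of_coeff_ne_zero hdeg' hc') hirr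
  have hc : F.coeff 5 ≠ 0 := by
    intro h0
    rw [coeff_map, h0] at hc'
    simp at hc'
  obtain ⟨A, B, D, hD, hAB⟩ := exists_bezout_derivative F hF
  refine ⟨F, A, B, D, hdeg, hc, hD, hAB, quinticForm_ne_zero F hdeg hc hF, fun x z => ?_⟩
  rw [← eval_homogenize_five, hf]

/-! ### Large primes: counting solutions of `f(v) = κ d w²` -/

/-- The number of prime divisors is small compared to the logarithm. -/
theorem exists_pow_card_primeFactors_le (b : ℕ) (hb : 1 ≤ b) :
    ∃ c : ℕ, 1 ≤ c ∧ ∀ d : ℕ, d ≠ 0 → b ^ d.primeFactors.card ≤ c * d := by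
  refine ⟨b ^ b, Nat.one_le_pow _ _ hb, fun d hd => ?_⟩
  calc b ^ d.primeFactors.card = ∏ p ∈ d.primeFactors, b := by simp
    -- A prime `p ≥ b` pays for its own factor `b`; fewer than `b` primes are smaller.
    _ ≤ ∏ p ∈ d.primeFactors, ((if p < b then b else 1) * p) := by
        refine Finset.prod_le_prod' fun p hp => ?_
        have hp1 := (Nat.prime_of_mem_primeFactors hp).one_lt
        split_ifs with h
        · exact Nat.le_mul_of_pos_right b (by omega)
        · omega
    _ = (∏ p ∈ d.primeFactors, (if p < b then b else 1)) * ∏ p ∈ d.primeFactors, p :=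
        Finset.prod_mul_distrib
    _ ≤ b ^ b * d := by
        refine Nat.mul_le_mul ?_ (Nat.le_of_dvd (by omega) (Nat.prod_primeFactors_dvd d))
        rw [← Finset.prod_filter, Finset.prod_const]
        refine Nat.pow_le_pow_right hb ?_
        have hsub : d.primeFactors.filter (· < b) ⊆ Finset.range b := fun p hp =>
          Finset.mem_range.mpr (Finset.mem_filter.mp hp).2
        simpa using Finset.card_le_card hsub

open Polynomial in
/-- Points with `d ∣ f(u)` fall into `5 ^ ω(d)` classes with pairwise determinants divisible
by `d`. -/
theorem card_le_of_card_class_le (F : ℤ[X]) (hF : F.natDegree ≤ 5) (d : ℕ) (hd : Squarefree d)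
    (hc : ∀ p : ℕ, p.Prime → p ∣ d → ¬ (p : ℤ) ∣ F.coeff 5) (S : Finset (ℤ × ℤ))
    (hS : ∀ u ∈ S, Int.gcd u.1 u.2 = 1 ∧ (d : ℤ) ∣ quinticForm F u.1 u.2) (b : ℕ)
    (hb : ∀ S' ⊆ S, (∀ u ∈ S', ∀ v ∈ S', (d : ℤ) ∣ u.1 * v.2 - u.2 * v.1) → S'.card ≤ b) :
    S.card ≤ b * 5 ^ d.primeFactors.card := by
  classical
  have hfact : ∀ p : d.primeFactors, Fact (p : ℕ).Prime :=
    fun p => ⟨Nat.prime_of_mem_primeFactors p.2⟩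
  have hslope : ∀ u ∈ S, ∀ p : d.primeFactors, (u.2 : ZMod (p : ℕ)) ≠ 0 ∧
      (u.1 / u.2 : ZMod (p : ℕ)) ∈ (F.map (Int.castRingHom (ZMod (p : ℕ)))).roots.toFinset := by
    intro u hu p
    have hpd := Nat.dvd_of_mem_primeFactors p.2
    exact slope_mem_roots F hF p (hc p (hfact p).out hpd) u.1 u.2 (hS u hu).1
      ((Int.natCast_dvd_natCast.mpr hpd).trans (hS u hu).2)
  refine (Finset.card_le_mul_card_image
    (f := fun (u : ℤ × ℤ) (p : d.primeFactors) => (u.1 / u.2 : ZMod (p : ℕ))) S b ?_).trans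
    (Nat.mul_le_mul_left _ ?_)
  · intro c hcc
    refine hb _ (Finset.filter_subset _ _) fun u hu v hv => ?_
    obtain ⟨huS, huc⟩ := Finset.mem_filter.mp hu
    obtain ⟨hvS, hvc⟩ := Finset.mem_filter.mp hv
    rw [← Nat.prod_primeFactors_of_squarefree hd, Nat.cast_prod]
    refine Finset.prod_dvd_of_coprime (fun p hp q hq hpq => ?_) fun p hp => ?_
    · exact Nat.isCoprime_iff_coprime.mpr ((Nat.coprime_primes
        (Nat.prime_of_mem_primeFactors hp) (Nat.prime_of_mem_primeFactors hq)).mpr hpq)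
    · have h1 := congrFun (huc.trans hvc.symm) ⟨p, hp⟩
      have := hfact ⟨p, hp⟩
      exact dvd_det_of_slope_eq p u.1 u.2 v.1 v.2 (hslope u huS ⟨p, hp⟩).1
        (hslope v hvS ⟨p, hp⟩).1 h1
  · have hsub : S.image (fun (u : ℤ × ℤ) (p : d.primeFactors) => (u.1 / u.2 : ZMod (p : ℕ)))
        ⊆ Fintype.piFinset fun p : d.primeFactors =>
          (F.map (Int.castRingHom (ZMod (p : ℕ)))).roots.toFinset := by
      intro c hcc
      obtain ⟨u, hu, rfl⟩ := Finset.mem_image.mp hcc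
      exact Fintype.mem_piFinset.mpr fun p => (hslope u hu p).2
    refine (Finset.card_le_card hsub).trans ?_
    rw [Fintype.card_piFinset]
    refine (Finset.prod_le_pow_card _ _ 5 fun p _ => rootSet_card_le_five F hF _).trans ?_
    simp

theorem mul_pow_le_of_le_sq (H n s T a : ℕ) (hn : 1 ≤ n) (ha : 3 ≤ a) (hTs : T ≤ s ^ 2)
    (hT3 : T ≤ 3 * n ^ 40) : H * n ^ 100 * T ^ 21 ≤ (a * H * n ^ 4 * s) ^ 40 := by
  have h1 : T ^ 20 ≤ s ^ 40 := by
    calc T ^ 20 ≤ (s ^ 2) ^ 20 := Nat.pow_le_pow_left hTs 20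
      _ = s ^ 40 := by ring
  have h2 : n ^ 140 ≤ n ^ 160 := Nat.pow_le_pow_right hn (by norm_num)
  have h3 : H ≤ H ^ 40 := Nat.le_self_pow (by norm_num) H
  have h4 : 3 ≤ a ^ 40 := ha.trans (Nat.le_self_pow (by norm_num) a)
  calc H * n ^ 100 * T ^ 21 = H * n ^ 100 * (T * T ^ 20) := by ring
    _ ≤ H * n ^ 100 * (3 * n ^ 40 * s ^ 40) := by gcongr
    _ = 3 * (H * n ^ 140 * s ^ 40) := by ring
    _ ≤ a ^ 40 * (H ^ 40 * n ^ 160 * s ^ 40) := by gcongr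
    _ = (a * H * n ^ 4 * s) ^ 40 := by ring

theorem two_mul_lt_pow (H n s a : ℕ) (hH : 1 ≤ H) (hn : 1 ≤ n) (hs : 1 ≤ s) (ha : 3 ≤ a) :
    2 * (H ^ 2 * n ^ 200) < (a * H * n ^ 4 * s) ^ 51 := by
  have h1 : n ^ 200 ≤ n ^ 204 := Nat.pow_le_pow_right hn (by norm_num)
  have h2 : H ^ 2 ≤ H ^ 51 := Nat.pow_le_pow_right hH (by norm_num)
  have h3 : 1 ≤ s ^ 51 := Nat.one_le_pow _ _ hs
  have h4 : 0 < H ^ 51 * n ^ 204 * s ^ 51 := by positivity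
  have h5 : 2 < a ^ 51 := Nat.lt_of_lt_of_le ha (Nat.le_self_pow (by norm_num) a)
  calc 2 * (H ^ 2 * n ^ 200) ≤ 2 * (H ^ 51 * n ^ 204) := by gcongr
    _ ≤ 2 * (H ^ 51 * n ^ 204 * s ^ 51) :=
        Nat.mul_le_mul_left _ (Nat.le_mul_of_pos_right _ h3)
    _ < a ^ 51 * (H ^ 51 * n ^ 204 * s ^ 51) := Nat.mul_lt_mul_of_pos_right h5 h4
    _ = (a * H * n ^ 4 * s) ^ 51 := by ring

open Polynomial in
/-- Solutions of `f(v) = κ w²` on a line in a box of size `n ^ 40`. -/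
theorem card_line_solutions_le (F : ℤ[X])
    (hF0 : ∀ x z : ℤ, x ≠ 0 ∨ z ≠ 0 → quinticForm F x z ≠ 0) (H n l : ℕ) (hH : 1 ≤ H)
    (hn : 1 ≤ n) (hl : 1 ≤ l) (hFH : ∑ i ∈ Finset.range 6, |F.coeff i| ≤ (H : ℤ) ^ 2)
    (e₁ e₂ : ℤ) (he : max |e₁| |e₂| = l) (κ : ℤ) (u : ℤ × ℤ) (S : Finset (ℤ × ℤ))
    (hS : ∀ v ∈ S, |v.1| ≤ (n : ℤ) ^ 40 ∧ |v.2| ≤ (n : ℤ) ^ 40 ∧ Int.gcd v.1 v.2 = 1 ∧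
      ∃ w : ℤ, quinticForm F v.1 v.2 = κ * w ^ 2)
    (hline : ∀ v ∈ S, ∃ t : ℤ, |t| * l ≤ 2 * (n : ℤ) ^ 40 ∧ v = (u.1 + t * e₁, u.2 + t * e₂)) :
    S.card ≤ 51 * (49 * (2 ^ 51 * (89 * H * n ^ 4 * (Nat.sqrt (2 * n ^ 40 / l + 1) + 1)))) := by
  classical
  set T := 2 * n ^ 40 / l + 1 with hT
  set s := Nat.sqrt T + 1 with hs
  have he0 : e₁ ≠ 0 ∨ e₂ ≠ 0 := by
    by_contra hcon
    push Not at hcon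
    rw [hcon.1, hcon.2] at he
    simp at he
    omega
  have hdeg := natDegree_linePolynomial F u.1 u.2 e₁ e₂ (hF0 e₁ e₂ he0)
  have hTs : T ≤ s ^ 2 := by
    have := Nat.lt_succ_sqrt T
    rw [sq]
    exact this.le
  have hT3 : T ≤ 3 * n ^ 40 := by
    have h1 : 2 * n ^ 40 / l ≤ 2 * n ^ 40 := Nat.div_le_self _ _
    have h2 : 1 ≤ n ^ 40 := Nat.one_le_pow _ _ hn
    omega
  have hs1 : 1 ≤ s := by omega
  -- The parameters are `k = 22`, with `89 > 4 * 22`, and `K = 51`. The factor `n ^ 4` absorbs the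
  -- bound `n ^ 100` for `w`, since `n ^ 100 T ^ 21 ≪ (n ^ 4 √T) ^ 40`, and makes `Q ^ 51` exceed
  -- twice the values of `f`, which are `≪ n ^ 200`.
  obtain ⟨Q, hQ⟩ : ∃ Q, Q = 89 * H * n ^ 4 * s := ⟨_, rfl⟩
  have hn4 : 1 ≤ n ^ 4 := Nat.one_le_pow _ _ hn
  have hQ88 : 4 * 22 < Q := by
    have : 1 ≤ H * n ^ 4 * s := Nat.mul_pos (Nat.mul_pos hH hn4) hs1
    rw [hQ]
    nlinarith
  have hWT : H * n ^ 100 * T ^ (22 - 1) ≤ Q ^ (2 * 22 - 4) := by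
    rw [hQ]
    exact mul_pow_le_of_le_sq H n s T 89 hn (by norm_num) hTs hT3
  have hV : 2 * (H ^ 2 * n ^ 200) < Q ^ 51 := by
    rw [hQ]
    exact two_mul_lt_pow H n s 89 hH hn hs1 (by norm_num)
  rw [← hQ]
  set R := (Finset.Icc (-(T : ℤ)) T).filter fun t => (u.1 + t * e₁, u.2 + t * e₂) ∈ S with hR
  have hSR : S ⊆ R.image fun t => (u.1 + t * e₁, u.2 + t * e₂) := by
    intro v hv
    obtain ⟨t, ht, rfl⟩ := hline v hv
    refine Finset.mem_image.mpr ⟨t, Finset.mem_filter.mpr ⟨?_, hv⟩, rfl⟩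
    rw [Finset.mem_Icc, ← abs_le]
    have h1 : |t| ≤ ((2 * n ^ 40 / l : ℕ) : ℤ) := by
      push_cast
      exact (Int.le_ediv_iff_mul_le (by exact_mod_cast hl)).mpr ht
    refine h1.trans ?_
    exact_mod_cast Nat.le_succ _
  refine (Finset.card_le_card hSR).trans (Finset.card_image_le.trans ?_)
  have hmain := card_curve_points_le (linePolynomial F u.1 u.2 e₁ e₂)
    (by rw [hdeg]; decide) κ 22 T (H * n ^ 100) Q 51 (H ^ 2 * n ^ 200) (Nat.le_add_left 1 _) (by norm_num)
    hQ88 hWT (Nat.mul_pos hH (Nat.one_le_pow _ _ hn)) hV R ?_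
  · rw [hdeg] at hmain
    exact hmain
  · intro t ht
    obtain ⟨htI, htS⟩ := Finset.mem_filter.mp ht
    obtain ⟨hb1, hb2, hg, w, hw⟩ := hS _ htS
    simp only at hb1 hb2 hg hw
    rw [eval_linePolynomial]
    have hne : quinticForm F (u.1 + t * e₁) (u.2 + t * e₂) ≠ 0 := by
      refine hF0 _ _ ?_
      by_contra hcon
      push Not at hcon
      rw [hcon.1, hcon.2] at hg
      simp at hg
    have hVb : |quinticForm F (u.1 + t * e₁) (u.2 + t * e₂)| ≤ (H : ℤ) ^ 2 * (n : ℤ) ^ 200 := by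
      refine (abs_quinticForm_le F _ _ _ hb1 hb2).trans ?_
      rw [← pow_mul]
      gcongr
    refine ⟨abs_le.mpr (Finset.mem_Icc.mp htI), hne, by exact_mod_cast hVb, w, ?_, hw⟩
    rw [hw] at hVb hne
    have hκ : κ ≠ 0 := fun h => hne (by rw [h, zero_mul])
    push_cast
    have hHn : (0 : ℤ) ≤ (H : ℤ) * (n : ℤ) ^ 100 := by positivity
    refine abs_le_of_sq_le_sq ?_ hHn
    calc w ^ 2 = 1 * |w ^ 2| := by rw [one_mul, abs_of_nonneg (sq_nonneg w)]
      _ ≤ |κ| * |w ^ 2| := by gcongr; exact Int.one_le_abs hκ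
      _ = |κ * w ^ 2| := (abs_mul _ _).symm
      _ ≤ _ := hVb
      _ = _ := by ring

open Polynomial in
/-- Solutions of `f(v) = κ w²` in one residue class modulo `d`. -/
theorem card_class_solutions_le (F : ℤ[X])
    (hF0 : ∀ x z : ℤ, x ≠ 0 ∨ z ≠ 0 → quinticForm F x z ≠ 0) (H n d : ℕ) (hH : 1 ≤ H)
    (hn : 1 ≤ n) (hFH : ∑ i ∈ Finset.range 6, |F.coeff i| ≤ (H : ℤ) ^ 2) (hd : 1 ≤ d)
    (hdM : d ≤ H ^ 2 * n ^ 44) (κ : ℤ) (S : Finset (ℤ × ℤ))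
    (hS : ∀ v ∈ S, |v.1| ≤ (n : ℤ) ^ 40 ∧ |v.2| ≤ (n : ℤ) ^ 40 ∧ Int.gcd v.1 v.2 = 1 ∧
      ∃ w : ℤ, quinticForm F v.1 v.2 = κ * w ^ 2)
    (hdet : ∀ u ∈ S, ∀ v ∈ S, (d : ℤ) ∣ u.1 * v.2 - u.2 * v.1) :
    S.card * d ≤ 51 * 49 * 2 ^ 51 * 89 * 16 * H ^ 2 * (n ^ 75 + d * n ^ 24) := by
  obtain ⟨l, hl, hld, hcard⟩ := card_le_of_dvd_det d (n ^ 40) hd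
    (fun l => 51 * (49 * (2 ^ 51 * (89 * H * n ^ 4 * (Nat.sqrt (2 * n ^ 40 / l + 1) + 1))))) S
    (fun u hu => (hS u hu).2.2.1)
    (fun u hu => by push_cast; exact ⟨(hS u hu).1, (hS u hu).2.1⟩) hdet
    (fun e₁ e₂ l hl _ he u _ S' hS' hline =>
      card_line_solutions_le F hF0 H n l hH hn hl hFH e₁ e₂ he κ u S'
        (fun v hv => hS v (hS' hv)) (by simpa using hline))
  set T := 2 * n ^ 40 / l + 1 with hT
  set s := Nat.sqrt T + 1 with hs
  have hsT : s ^ 2 ≤ 4 * T := by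
    have h1 := Nat.sqrt_le' T
    have h2 : 1 ≤ Nat.sqrt T := Nat.le_sqrt'.mpr (Nat.le_add_left 1 _)
    rw [hs]
    nlinarith
  have hTl : T * l ≤ 2 * n ^ 40 + l := by
    have := Nat.div_mul_le_self (2 * n ^ 40) l
    rw [hT, add_mul]
    omega
  have hn40 : 1 ≤ n ^ 40 := Nat.one_le_pow _ _ hn
  have hT3 : T ≤ 3 * n ^ 40 := by
    have h1 : 2 * n ^ 40 / l ≤ 2 * n ^ 40 := Nat.div_le_self _ _
    omega
  have hs20 : s ≤ 4 * n ^ 20 := by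
    refine (Nat.pow_le_pow_iff_left two_ne_zero).mp ?_
    calc s ^ 2 ≤ 4 * (3 * n ^ 40) := hsT.trans (Nat.mul_le_mul_left _ hT3)
      _ ≤ (4 * n ^ 20) ^ 2 := by
        rw [show (4 * n ^ 20) ^ 2 = 16 * n ^ 40 by ring]
        omega
  have hl22 : l ≤ H * n ^ 22 := by
    refine (Nat.pow_le_pow_iff_left two_ne_zero).mp (hld.trans (hdM.trans ?_))
    exact (by ring : H ^ 2 * n ^ 44 = (H * n ^ 22) ^ 2).le
  -- Since `s ≈ √T` and `T l ≪ n ^ 40`, the product `l s` is about `√(n ^ 40 l)`, which is `≪ n ^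
  -- 31` by `l ≪ n ^ 22`.
  have hls : l * s ≤ 4 * (H * n ^ 31) := by
    refine (Nat.pow_le_pow_iff_left two_ne_zero).mp ?_
    have h1 : l ≤ H * n ^ 40 :=
      hl22.trans (Nat.mul_le_mul_left _ (Nat.pow_le_pow_right hn (by norm_num)))
    have h2 : n ^ 40 ≤ H * n ^ 40 := Nat.le_mul_of_pos_left _ hH
    calc (l * s) ^ 2 = l * (l * s ^ 2) := by ring
      _ ≤ l * (l * (4 * T)) := by gcongr
      _ = 4 * l * (T * l) := by ring
      _ ≤ 4 * (H * n ^ 22) * (4 * (H * n ^ 40)) := by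
          refine Nat.mul_le_mul (Nat.mul_le_mul_left _ hl22) (hTl.trans ?_)
          omega
      _ = (4 * (H * n ^ 31)) ^ 2 := by ring
  have hdiv : (2 * (2 * n ^ 40 * l / d) + 1) * d ≤ 4 * n ^ 40 * l + d := by
    have := Nat.div_mul_le_self (2 * n ^ 40 * l) d
    rw [add_mul, one_mul, mul_assoc]
    linarith
  calc S.card * d
      ≤ 51 * (49 * (2 ^ 51 * (89 * H * n ^ 4 * s))) * ((2 * (2 * n ^ 40 * l / d) + 1) * d) := by
        rw [← mul_assoc]
        exact Nat.mul_le_mul_right _ hcard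
    _ ≤ 51 * (49 * (2 ^ 51 * (89 * H * n ^ 4 * s))) * (4 * n ^ 40 * l + d) :=
        Nat.mul_le_mul_left _ hdiv
    _ = 51 * 49 * 2 ^ 51 * 89 * H * (4 * n ^ 44 * (l * s) + d * n ^ 4 * s) := by ring
    _ ≤ 51 * 49 * 2 ^ 51 * 89 * H *
          (4 * n ^ 44 * (4 * (H * n ^ 31)) + d * n ^ 4 * (4 * n ^ 20)) := by gcongr
    _ = 51 * 49 * 2 ^ 51 * 89 * H * (16 * (H * n ^ 75) + 4 * (1 * (d * n ^ 24))) := by ring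
    _ ≤ 51 * 49 * 2 ^ 51 * 89 * H * (16 * (H * n ^ 75) + 16 * (H * (d * n ^ 24))) := by
        gcongr; norm_num
    _ = 51 * 49 * 2 ^ 51 * 89 * 16 * H ^ 2 * (n ^ 75 + d * n ^ 24) := by ring

/-- Splitting off the square part of an integer and the part shared with `a`. -/
theorem exists_squarefree_decomposition (a m : ℤ) (ha : a ≠ 0) (hm : m ≠ 0) :
    ∃ (κ b : ℤ) (d : ℕ), m = κ * d * b ^ 2 ∧ |κ| ≤ |a| ∧ Squarefree d ∧ 1 ≤ d ∧
      (d : ℤ) ≤ |m| ∧ ∀ p : ℕ, p.Prime → p ∣ d → ¬ (p : ℤ) ∣ a := by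
  obtain ⟨s, b, hsb, hs⟩ := Nat.sq_mul_squarefree m.natAbs
  -- As `s` is squarefree, removing `gcd(s, a)` once leaves `d` prime to `a`.
  set c := Nat.gcd s a.natAbs with hc
  have hs0 : s ≠ 0 := hs.ne_zero
  have hcs : c ∣ s := Nat.gcd_dvd_left _ _
  have hc0 : 0 < c := Nat.pos_of_dvd_of_pos hcs (by omega)
  obtain ⟨d, hd⟩ := hcs
  have hd0 : d ≠ 0 := by rintro rfl; simp at hd; omega
  have hb0 : b ≠ 0 := by
    rintro rfl
    simp at hsb
    omega
  refine ⟨m.sign * c, b, d, ?_, ?_, hs.squarefree_of_dvd ⟨c, by rw [hd, mul_comm]⟩, by omega,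
    ?_, ?_⟩
  · calc m = m.sign * m.natAbs := (Int.sign_mul_natAbs m).symm
      _ = m.sign * c * d * (b : ℤ) ^ 2 := by
        rw [← hsb, hd]
        push_cast
        ring
  · rw [abs_mul, Int.abs_sign_of_ne_zero hm, one_mul, Nat.abs_cast, Int.abs_eq_natAbs]
    exact_mod_cast Nat.le_of_dvd (Int.natAbs_pos.mpr ha) (Nat.gcd_dvd_right _ _)
  · rw [Int.abs_eq_natAbs, ← hsb, hd]
    have h1 : 1 ≤ b ^ 2 := Nat.one_le_pow _ _ (by omega)
    have h2 : d ≤ b ^ 2 * (c * d) := by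
      calc d = 1 * (1 * d) := by ring
        _ ≤ b ^ 2 * (c * d) := by gcongr; omega
    exact_mod_cast h2
  · intro p hp hpd hpa
    have h1 : p ∣ c := Nat.dvd_gcd (hd ▸ hpd.mul_left c) (Int.natCast_dvd.mp hpa)
    have h2 : p * p ∣ s := hd ▸ mul_dvd_mul h1 hpd
    exact hp.one_lt.ne' (Nat.isUnit_iff.mp (hs p h2))

open Polynomial in
theorem exists_card_twist_le (F : ℤ[X]) (hF : F.natDegree ≤ 5)
    (hF0 : ∀ x z : ℤ, x ≠ 0 ∨ z ≠ 0 → quinticForm F x z ≠ 0) (H : ℕ) (hH : 1 ≤ H)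
    (hFH : ∑ i ∈ Finset.range 6, |F.coeff i| ≤ (H : ℤ) ^ 2) :
    ∃ K : ℕ, ∀ n d : ℕ, 1 ≤ n → Squarefree d → 1 ≤ d → d ≤ H ^ 2 * n ^ 44 →
      (∀ p : ℕ, p.Prime → p ∣ d → ¬ (p : ℤ) ∣ F.coeff 5) → ∀ (κ : ℤ) (S : Finset (ℤ × ℤ)),
      (∀ v ∈ S, |v.1| ≤ (n : ℤ) ^ 40 ∧ |v.2| ≤ (n : ℤ) ^ 40 ∧ Int.gcd v.1 v.2 = 1 ∧
        ∃ w : ℤ, quinticForm F v.1 v.2 = κ * d * w ^ 2) →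
      S.card * d ≤ K * n * (n ^ 75 + d * n ^ 24) := by
  -- The base `5 ^ 44` matches `d ≪ n ^ 44`: taking 44th roots bounds the number of classes by a
  -- multiple of `n`.
  obtain ⟨c, hc1, hc⟩ := exists_pow_card_primeFactors_le (5 ^ 44) (by norm_num)
  obtain ⟨A, hA⟩ : ∃ A, A = 51 * 49 * 2 ^ 51 * 89 * 16 * H ^ 2 := ⟨_, rfl⟩
  refine ⟨A * (c * H ^ 2), fun n d hn hsq hd hdM hp κ S hS => ?_⟩
  have hω : 5 ^ d.primeFactors.card ≤ c * H ^ 2 * n := by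
    refine (Nat.pow_le_pow_iff_left (n := 44) (by norm_num)).mp ?_
    have h1 : 1 ≤ c * H ^ 2 := Nat.mul_pos hc1 (Nat.one_le_pow _ _ hH)
    calc (5 ^ d.primeFactors.card) ^ 44 = (5 ^ 44) ^ d.primeFactors.card := by
          rw [← pow_mul, ← pow_mul, mul_comm]
      _ ≤ c * d := hc d (by omega)
      _ ≤ c * (H ^ 2 * n ^ 44) := Nat.mul_le_mul_left _ hdM
      _ = (c * H ^ 2) * n ^ 44 := by ring
      _ ≤ (c * H ^ 2) ^ 44 * n ^ 44 := by
          gcongr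
          exact Nat.le_self_pow (by norm_num) _
      _ = (c * H ^ 2 * n) ^ 44 := (mul_pow _ _ _).symm
  have hcard := card_le_of_card_class_le F hF d hsq hp S
    (fun u hu => ⟨(hS u hu).2.2.1, by
      obtain ⟨w, hw⟩ := (hS u hu).2.2.2
      exact ⟨κ * w ^ 2, by rw [hw]; ring⟩⟩)
    (A * (n ^ 75 + d * n ^ 24) / d) (fun S' hS' hdet => by
      rw [Nat.le_div_iff_mul_le (by omega), hA]
      exact card_class_solutions_le F hF0 H n d hH hn hFH hd hdM (κ * d) S'
        (fun v hv => hS v (hS' hv)) hdet)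
  calc S.card * d ≤ A * (n ^ 75 + d * n ^ 24) / d * 5 ^ d.primeFactors.card * d :=
        Nat.mul_le_mul_right _ hcard
    _ = (A * (n ^ 75 + d * n ^ 24) / d * d) * 5 ^ d.primeFactors.card := by ring
    _ ≤ (A * (n ^ 75 + d * n ^ 24)) * (c * H ^ 2 * n) :=
        Nat.mul_le_mul (Nat.div_mul_le_self _ _) hω
    _ = A * (c * H ^ 2) * n * (n ^ 75 + d * n ^ 24) := by ring

theorem sum_inv_le (H n : ℕ) (hH : 1 ≤ H) (hn : 1 ≤ n) :
    ∑ d ∈ Finset.Icc 1 (H ^ 2 * n ^ 44), ((d : ℝ))⁻¹ ≤ 47 * H * n := by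
  have h1 := harmonic_le_one_add_log (H ^ 2 * n ^ 44)
  rw [harmonic_eq_sum_Icc] at h1
  push_cast at h1
  have hH' : (1 : ℝ) ≤ H := by exact_mod_cast hH
  have hn' : (1 : ℝ) ≤ n := by exact_mod_cast hn
  rw [Real.log_mul (by positivity) (by positivity), Real.log_pow, Real.log_pow] at h1
  have h2 := Real.log_le_self (x := (H : ℝ)) (by linarith)
  have h3 := Real.log_le_self (x := (n : ℝ)) (by linarith)
  push_cast at h1
  nlinarith

open Polynomial in
/-- The pairs for which the square of a prime exceeding `n ^ 78` divides the form. -/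
theorem exists_card_large_primes_le (F : ℤ[X]) (hF : F.natDegree ≤ 5) (hc : F.coeff 5 ≠ 0)
    (hF0 : ∀ x z : ℤ, x ≠ 0 ∨ z ≠ 0 → quinticForm F x z ≠ 0) :
    ∃ C : ℝ, 0 ≤ C ∧ ∀ (n : ℕ), 1 ≤ n → ∀ S : Finset (ℤ × ℤ),
      (∀ u ∈ S, |u.1| ≤ (n : ℤ) ^ 40 ∧ |u.2| ≤ (n : ℤ) ^ 40 ∧ Int.gcd u.1 u.2 = 1 ∧
        ∃ p : ℕ, n ^ 78 ≤ p ∧ (p : ℤ) ^ 2 ∣ quinticForm F u.1 u.2) →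
      (S.card : ℝ) ≤ C * (n : ℝ) ^ 78 := by
  classical
  obtain ⟨H, hH, hFH⟩ : ∃ H : ℕ, 1 ≤ H ∧ ∑ i ∈ Finset.range 6, |F.coeff i| ≤ (H : ℤ) ^ 2 := by
    have h0 : 0 ≤ ∑ i ∈ Finset.range 6, |F.coeff i| := Finset.sum_nonneg fun _ _ => abs_nonneg _
    obtain ⟨m, hm⟩ := Int.eq_ofNat_of_zero_le h0
    refine ⟨m + 1, by omega, ?_⟩
    rw [hm]
    push_cast
    nlinarith
  obtain ⟨K, hK⟩ := exists_card_twist_le F hF hF0 H hH hFH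
  set a := (F.coeff 5).natAbs with ha
  refine ⟨(2 * a + 1) * (K * (47 * H + H ^ 2)), by positivity, fun n hn S hS => ?_⟩
  set M := H ^ 2 * n ^ 44 with hM
  let good : ℕ → Prop := fun d =>
    Squarefree d ∧ ∀ p : ℕ, p.Prime → p ∣ d → ¬ (p : ℤ) ∣ F.coeff 5
  let T : ℤ → ℕ → Finset (ℤ × ℤ) := fun κ d =>
    S.filter fun u => good d ∧ ∃ w : ℤ, quinticForm F u.1 u.2 = κ * d * w ^ 2
  have hcover : S ⊆ (Finset.Icc (-(a : ℤ)) a).biUnion fun κ =>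
      (Finset.Icc 1 M).biUnion fun d => T κ d := by
    intro u hu
    obtain ⟨hu1, hu2, hg, p, hp, m, hm⟩ := hS u hu
    have hne : quinticForm F u.1 u.2 ≠ 0 := by
      refine hF0 _ _ ?_
      by_contra hcon
      push Not at hcon
      rw [hcon.1, hcon.2] at hg
      simp at hg
    have hm0 : m ≠ 0 := by
      rintro rfl
      exact hne (by rw [hm, mul_zero])
    -- Dividing `|f| ≤ H² n ^ 200` by `p² ≥ n ^ 156` leaves `H² n ^ 44`.
    have hmM : |m| ≤ (M : ℤ) := by
      have h1 := abs_quinticForm_le F _ _ _ hu1 hu2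
      rw [hm, abs_mul, abs_pow, Nat.abs_cast] at h1
      have h2 : ((n : ℤ) ^ 78) ^ 2 ≤ (p : ℤ) ^ 2 := by
        have : (n : ℤ) ^ 78 ≤ p := by exact_mod_cast hp
        gcongr
      have hn0 : (0 : ℤ) < (n : ℤ) ^ 156 := by positivity
      refine le_of_mul_le_mul_left ?_ hn0
      calc (n : ℤ) ^ 156 * |m| = ((n : ℤ) ^ 78) ^ 2 * |m| := by ring
        _ ≤ (p : ℤ) ^ 2 * |m| := by gcongr
        _ ≤ _ := h1
        _ ≤ (H : ℤ) ^ 2 * ((n : ℤ) ^ 40) ^ 5 := by gcongr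
        _ = (n : ℤ) ^ 156 * M := by rw [hM]; push_cast; ring
    obtain ⟨κ, b, d, hmd, hκ, hsq, hd1, hdm, hpd⟩ :=
      exists_squarefree_decomposition (F.coeff 5) m hc hm0
    refine Finset.mem_biUnion.mpr ⟨κ, ?_, Finset.mem_biUnion.mpr ⟨d, ?_,
      Finset.mem_filter.mpr ⟨hu, ⟨hsq, hpd⟩, p * b, ?_⟩⟩⟩
    · rw [Finset.mem_Icc, ← abs_le, ha, ← Int.abs_eq_natAbs]
      exact hκ
    · exact Finset.mem_Icc.mpr ⟨hd1, by exact_mod_cast hdm.trans hmM⟩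
    · rw [hm, hmd]
      ring
  have hT : ∀ κ, ∀ d ∈ Finset.Icc 1 M,
      ((T κ d).card : ℝ) ≤ K * n * (n ^ 75 * (d : ℝ)⁻¹ + n ^ 24) := by
    intro κ d hd
    obtain ⟨hd1, hdM⟩ := Finset.mem_Icc.mp hd
    have hd0 : (0 : ℝ) < d := by exact_mod_cast hd1
    by_cases hgood : good d
    · have h1 := hK n d hn hgood.1 hd1 hdM hgood.2 κ (T κ d) (fun v hv => by
        obtain ⟨hvS, -, hw⟩ := Finset.mem_filter.mp hv
        obtain ⟨hv1, hv2, hg, -⟩ := hS v hvS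
        exact ⟨hv1, hv2, hg, hw⟩)
      have h2 : ((T κ d).card : ℝ) * d ≤ K * n * (n ^ 75 + d * n ^ 24) := by exact_mod_cast h1
      refine le_of_mul_le_mul_right (h2.trans (le_of_eq ?_)) hd0
      field_simp
    · have : T κ d = ∅ := Finset.filter_eq_empty_iff.mpr fun u _ h => hgood h.1
      rw [this]
      simp only [Finset.card_empty, Nat.cast_zero]
      positivity
  have hn' : (1 : ℝ) ≤ n := by exact_mod_cast hn
  have hsum : ∀ κ, (((Finset.Icc 1 M).biUnion fun d => T κ d).card : ℝ)
      ≤ K * (47 * H + H ^ 2) * (n : ℝ) ^ 78 := by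
    intro κ
    calc (((Finset.Icc 1 M).biUnion fun d => T κ d).card : ℝ)
        ≤ ∑ d ∈ Finset.Icc 1 M, ((T κ d).card : ℝ) := by
          exact_mod_cast Finset.card_biUnion_le
      _ ≤ ∑ d ∈ Finset.Icc 1 M, (K * n * (n ^ 75 * (d : ℝ)⁻¹ + n ^ 24) : ℝ) :=
          Finset.sum_le_sum (hT κ)
      _ = K * n * (n ^ 75 * ∑ d ∈ Finset.Icc 1 M, (d : ℝ)⁻¹ + M * n ^ 24) := by
          rw [← Finset.mul_sum, Finset.sum_add_distrib, ← Finset.mul_sum]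
          simp
      _ ≤ K * n * (n ^ 75 * (47 * H * n) + M * n ^ 24) := by
          gcongr
          exact sum_inv_le H n hH hn
      _ = K * (47 * H * (n : ℝ) ^ 77 + H ^ 2 * (n : ℝ) ^ 69) := by
          rw [hM]
          push_cast
          ring
      _ ≤ K * (47 * H * (n : ℝ) ^ 78 + H ^ 2 * (n : ℝ) ^ 78) := by
          gcongr <;> first | exact hn' | norm_num
      _ = K * (47 * H + H ^ 2) * (n : ℝ) ^ 78 := by ring
  calc (S.card : ℝ) ≤ (((Finset.Icc (-(a : ℤ)) a).biUnion fun κ =>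
          (Finset.Icc 1 M).biUnion fun d => T κ d).card : ℝ) := by
        exact_mod_cast Finset.card_le_card hcover
    _ ≤ ∑ κ ∈ Finset.Icc (-(a : ℤ)) a, (((Finset.Icc 1 M).biUnion fun d => T κ d).card : ℝ) := by
        exact_mod_cast Finset.card_biUnion_le
    _ ≤ ∑ κ ∈ Finset.Icc (-(a : ℤ)) a, (K * (47 * H + H ^ 2) * (n : ℝ) ^ 78 : ℝ) :=
        Finset.sum_le_sum fun κ _ => hsum κ
    _ = (2 * a + 1) * (K * (47 * H + H ^ 2)) * (n : ℝ) ^ 78 := by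
        rw [Finset.sum_const, Int.card_Icc, nsmul_eq_mul,
          show ((a : ℤ) + 1 - -(a : ℤ)).toNat = 2 * a + 1 by omega]
        push_cast
        ring

/-! ### Combining medium and large primes -/

theorem largeSquareDivisorCount_le_sq (f : MvPolynomial (Fin 2) ℤ) (N : ℕ) :
    largeSquareDivisorCount f N ≤ (2 * N + 1) ^ 2 := by
  classical
  have hsub : largeSquareDivisorPairs f N ⊆
      ((Finset.Icc (-(N : ℤ)) N ×ˢ Finset.Icc (-(N : ℤ)) N : Finset (ℤ × ℤ)) : Set (ℤ × ℤ)) := by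
    rintro ⟨x, z⟩ ⟨hx, hz, -⟩
    rw [Finset.mem_coe, Finset.mem_product, Finset.mem_Icc, Finset.mem_Icc]
    exact ⟨abs_le.mp hx, abs_le.mp hz⟩
  refine (Set.ncard_le_ncard hsub (Finset.finite_toSet _)).trans ?_
  rw [Set.ncard_coe_finset, Finset.card_product, Int.card_Icc, sq,
    show ((N : ℤ) + 1 - -(N : ℤ)).toNat = 2 * N + 1 by omega]

theorem mainTheorem6 (f : MvPolynomial (Fin 2) ℤ) (hhom : f.IsHomogeneous 5)
    (hirr : Irreducible (MvPolynomial.map (Int.castRingHom ℚ) f)) :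
    ∀ ε : ℝ, 0 < ε → ∃ C : ℝ, 0 < C ∧ ∀ N : ℕ, 1 ≤ N →
      (largeSquareDivisorCount f N : ℝ) ≤ C * (N : ℝ) ^ ((5 + Real.sqrt 113) / 8 + ε) := by
  classical
  intro ε hε
  obtain ⟨F, A, B, D, hF, hc, hD, hAB, hF0, hfF⟩ := exists_dehomogenization f hhom hirr
  obtain ⟨C, hC0, hC⟩ := exists_card_large_primes_le F hF hc hF0
  set N₀ := (|D| + |F.coeff 5|).toNat with hN₀
  -- The value `10.6` is exactly what is needed: `(5 + 10.6) / 8 = 78 / 40`.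
  have hsqrt : (10.6 : ℝ) ≤ Real.sqrt 113 := Real.le_sqrt_of_sq_le (by norm_num)
  refine ⟨(20 + C) * 2 ^ 78 + (2 * N₀ + 1) ^ 2, by positivity, fun N hN => ?_⟩
  have hN1 : (1 : ℝ) ≤ N := by exact_mod_cast hN
  have hpow1 : 1 ≤ (N : ℝ) ^ ((5 + Real.sqrt 113) / 8 + ε) :=
    Real.one_le_rpow hN1 (by positivity)
  rw [add_mul]
  -- For `N ≥ N₀` no prime `p > N` divides `D` or `F₅`; smaller `N` are absorbed by the trivial
  -- bound.
  rcases lt_or_ge N N₀ with hlt | hge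
  · have h1 : (largeSquareDivisorCount f N : ℝ) ≤ (2 * N₀ + 1) ^ 2 := by
      have h2 := largeSquareDivisorCount_le_sq f N
      have h3 : (2 * N + 1) ^ 2 ≤ (2 * N₀ + 1) ^ 2 := by gcongr
      exact_mod_cast h2.trans h3
    have h4 : 0 ≤ (20 + C) * 2 ^ 78 * (N : ℝ) ^ ((5 + Real.sqrt 113) / 8 + ε) := by positivity
    have h5 : ((2 * N₀ + 1) ^ 2 : ℝ) ≤
        (2 * N₀ + 1) ^ 2 * (N : ℝ) ^ ((5 + Real.sqrt 113) / 8 + ε) :=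
      le_mul_of_one_le_right (by positivity) hpow1
    linarith
  · set r : ℝ := (N : ℝ) ^ (1 / 40 : ℝ) with hr
    have hr1 : 1 ≤ r := Real.one_le_rpow hN1 (by norm_num)
    set n := ⌈r⌉₊ with hn
    have hrn : r ≤ n := Nat.le_ceil r
    have hn2 : (n : ℝ) ≤ 2 * r := by
      have := Nat.ceil_lt_add_one (a := r) (by linarith)
      linarith
    have hn1 : 1 ≤ n := by exact_mod_cast hr1.trans hrn
    have hr40 : r ^ 40 = N := by
      rw [hr, ← Real.rpow_natCast, ← Real.rpow_mul (by positivity)]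
      norm_num
    have hNn : N ≤ n ^ 40 := by
      have : (N : ℝ) ≤ (n : ℝ) ^ 40 := by
        rw [← hr40]
        gcongr
      exact_mod_cast this
    have hNn' : (N : ℤ) ≤ (n : ℤ) ^ 40 := by exact_mod_cast hNn
    have hr78 : r ^ 78 ≤ (N : ℝ) ^ ((5 + Real.sqrt 113) / 8 + ε) := by
      rw [hr, ← Real.rpow_natCast, ← Real.rpow_mul (by positivity)]
      refine Real.rpow_le_rpow_of_exponent_le hN1 ?_
      push_cast
      linarith
    set S := (largeSquareDivisorPairs_finite f N).toFinset with hS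
    have hScard : largeSquareDivisorCount f N = S.card :=
      Set.ncard_eq_toFinset_card _ (largeSquareDivisorPairs_finite f N)
    have hmem : ∀ u ∈ S, |u.1| ≤ (N : ℤ) ∧ |u.2| ≤ (N : ℤ) ∧ Int.gcd u.1 u.2 = 1 ∧
        ∃ p : ℕ, p.Prime ∧ N < p ∧ (p : ℤ) ^ 2 ∣ quinticForm F u.1 u.2 := by
      intro u hu
      obtain ⟨h1, h2, h3, p, hp, hNp, hd⟩ := (Set.Finite.mem_toFinset _).mp hu
      exact ⟨h1, h2, h3, p, hp, hNp, by rwa [hfF] at hd⟩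
    let big : ℤ × ℤ → Prop := fun u =>
      ∃ p : ℕ, n ^ 78 ≤ p ∧ (p : ℤ) ^ 2 ∣ quinticForm F u.1 u.2
    have hbig : ((S.filter big).card : ℝ) ≤ C * (n : ℝ) ^ 78 := by
      refine hC n hn1 _ fun u hu => ?_
      obtain ⟨huS, hub⟩ := Finset.mem_filter.mp hu
      obtain ⟨h1, h2, h3, -⟩ := hmem u huS
      exact ⟨h1.trans hNn', h2.trans hNn', h3, hub⟩
    have hsmall : (S.filter fun u => ¬ big u).card ≤ 20 * n ^ 78 := by
      refine card_medium_primes_le F A B D hF hAB hD hc N (n ^ 78) ?_ _ fun u hu => ?_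
      · have : 0 ≤ |D| + |F.coeff 5| := by positivity
        omega
      · obtain ⟨huS, hub⟩ := Finset.mem_filter.mp hu
        obtain ⟨h1, h2, h3, p, hp, hNp, hd⟩ := hmem u huS
        refine ⟨h1, h2, h3, p, hp, hNp, ?_, hd⟩
        by_contra hcon
        exact hub ⟨p, by omega, hd⟩
    have hsmall' : ((S.filter fun u => ¬ big u).card : ℝ) ≤ 20 * (n : ℝ) ^ 78 := by
      exact_mod_cast hsmall
    have htotal : (S.card : ℝ) ≤ (20 + C) * (n : ℝ) ^ 78 := by
      rw [← Finset.card_filter_add_card_filter_not (s := S) big]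
      push_cast
      linarith
    have hn78 : (n : ℝ) ^ 78 ≤ 2 ^ 78 * r ^ 78 := by
      rw [← mul_pow]
      gcongr
    rw [hScard]
    calc (S.card : ℝ) ≤ (20 + C) * (n : ℝ) ^ 78 := htotal
      _ ≤ (20 + C) * (2 ^ 78 * (N : ℝ) ^ ((5 + Real.sqrt 113) / 8 + ε)) := by
          refine mul_le_mul_of_nonneg_left (hn78.trans ?_) (by positivity)
          gcongr
      _ = (20 + C) * 2 ^ 78 * (N : ℝ) ^ ((5 + Real.sqrt 113) / 8 + ε) := by ring
      _ ≤ _ := le_add_of_nonneg_right (by positivity)
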